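/- **Setting.** Let $K$ be a field with a valuation (for instance a complete discrete valuation field), $A=K[X_1,\dots,X_n]$, $A_d$ its homogeneous part of degree $d$, and $w$ a monomial order on $A$. For an ideal $I$ let $LM(I)$ be the set of leading monomials of the nonzero elements of $I$. The ideal $I$ is a *weakly-$w$-ideal* if for every leading monomial $x^\alpha$ of an element of the reduced Gröbner basis of $I$, every monomial $x^\beta > x^\alpha$ with $|\beta|=|\alpha|$ lies in $LM(I)$. A finite sequence $G$ of elements of $I$ is a *$D$-Gröbner basis* of $I$ if for every nonzero homogeneous $p\in I$ of degree at most $D$ there is a nonzero $g\in G$ with $LM(g)\mid LM(p)$. Let $f_1,\dots,f_s\in A$ be homogeneous of degrees $d_1,\dots,d_s$. Consider the hypotheses * **H1**: $(f_1,\dots,f_s)$ is a regular sequence, that is, for every $i$ multiplication by $f_i$ is injective on $A/\langle f_1,\dots,f_{i-1}\rangle$; * **H2**: every ideal $\langle f_1,\dots,f_i\rangle$, $1\le i\le s$, is a weakly-$w$-ideal. **Algorithm weak-MF5** (exact arithmetic), with input $(f_1,\dots,f_s)$ and $D\in\mathbb Z_{\ge 0}$. Matrices of degree $d$ have columns indexed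 by the monomials of degree $d$ in decreasing order for $w$, and their rows are identified with elements of $A_d$. Start with $G=\emptyset$. For $d=0,\dots,D$ put $M_{d,0}=\widetilde M_{d,0}=\emptyset$, and for $i=1,\dots,s$: 1. Let $M_{d,i}$ be $\widetilde M_{d,i-1}$ (or, in a variant, $M_{d,i-1}$) with the rows $x^\alpha f_i$ added, for all $\alpha$ with $|\alpha|+d_i=d$ such that $x^\alpha$ is not the leading monomial of a row of $\widetilde M_{d-d_i,i-1}$. 2. Perform Gaussian elimination on $M_{d,i}$, taking as pivot in each column an entry of smallest valuation among the rows not yet used, and stop at the first column without nonzero pivot. 3. Replace the remaining rows (those not used as pivot rows) by the same number of products $X_kP$ of a variable by a row $P$ of $\widetilde M_{d-1,i}$, so that an injective matrix in row-echelon form up to permutation of the rows is obtained (its rows are nonzero with pairwise distinct leading monomials); call it $\widetilde M_{d,i}$. If this is impossible, raise an error and stop. 4. Add to $G$ the rows of $\widetilde M_{d,i}$ whose leading monomial is not the leading monomial of an element of $G$. At the end return $G$. Ties between pivots and the choice of the completion in step 3 are resolved arbitrarily. **Proposition (correctness).** Both for the algorithm and for its variant, and for every way of resolving the choices: 1. for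 every $D\ge 0$ the algorithm terminates: it returns some $G$ or raises an error; 2. if $(f_1,\dots,f_s)$ satisfies H1 and H2, then for every $D\ge 0$ no error is raised and the result $G$ is a $D$-Gröbner basis of $\langle f_1,\dots,f_s\rangle$; 3. if H1 or H2 fails, then there is $D_0$ such that an error is raised for every $D\ge D_0$. -/

import Mathlib

namespace WeakMF5

section

variable {K : Type*} [Field K] {n s : ℕ}

/-! ### Gröbner bases, weakly-`w` ideals, the structure hypotheses -/

/-- `x^α` is the leading monomial of the (nonzero) polynomial `p`. -/
def IsLM (w : MonomialOrder (Fin n)) (p : MvPolynomial (Fin n) K) (α : Fin n →₀ ℕ) : Prop :=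
  p ≠ 0 ∧ w.degree p = α

/-- `LM(I)`: the set of (exponents of) leading monomials of the nonzero elements of `I`. -/
def LM (w : MonomialOrder (Fin n)) (I : Ideal (MvPolynomial (Fin n) K)) : Set (Fin n →₀ ℕ) :=
  {α | ∃ p ∈ I, IsLM w p α}

/-- `G` is a Gröbner basis of `I`. Divisibility of monomials is the pointwise order of exponents. -/
def IsGroebnerBasis (w : MonomialOrder (Fin n)) (I : Ideal (MvPolynomial (Fin n) K))
    (G : Finset (MvPolynomial (Fin n) K)) : Prop :=
  (∀ g ∈ G, g ∈ I) ∧ ∀ p ∈ I, p ≠ 0 → ∃ g ∈ G, g ≠ 0 ∧ w.degree g ≤ w.degree p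

/-- `G` is the reduced Gröbner basis of `I`: its elements are monic, and no monomial occurring in
an element of `G` is divisible by the leading monomial of another element. -/
def IsReducedGroebnerBasis (w : MonomialOrder (Fin n)) (I : Ideal (MvPolynomial (Fin n) K))
    (G : Finset (MvPolynomial (Fin n) K)) : Prop :=
  IsGroebnerBasis w I G ∧ (∀ g ∈ G, w.leadingCoeff g = 1) ∧
    ∀ g ∈ G, ∀ h ∈ G, h ≠ g → ∀ γ ∈ g.support, ¬ w.degree h ≤ γ

/-- `I` is a weakly-`w`-ideal: every monomial which is greater than, and of the same degree as, a
leading monomial `x^α` of the reduced Gröbner basis of `I` belongs to `LM(I)`. -/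
def IsWeaklyW (w : MonomialOrder (Fin n)) (I : Ideal (MvPolynomial (Fin n) K)) : Prop :=
  ∀ G, IsReducedGroebnerBasis w I G → ∀ g ∈ G, ∀ β : Fin n →₀ ℕ,
    β.degree = (w.degree g).degree → w.toSyn (w.degree g) < w.toSyn β → β ∈ LM w I

/-- The finite list `G` is a `D`-Gröbner basis of `I`. -/
def IsDGroebnerBasis (w : MonomialOrder (Fin n)) (D : ℕ) (I : Ideal (MvPolynomial (Fin n) K))
    (G : List (MvPolynomial (Fin n) K)) : Prop :=
  (∀ g ∈ G, g ∈ I) ∧ ∀ p ∈ I, p ≠ 0 → ∀ d ≤ D, p.IsHomogeneous d →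
    ∃ g ∈ G, g ≠ 0 ∧ w.degree g ≤ w.degree p

/-- The hypothesis H1, `(f₁, …, f_s)` is a regular sequence: multiplication by `f_i` is injective
on the quotient by `⟨f₁, …, f_{i-1}⟩`. For homogeneous polynomials of positive degree the
quotient by `⟨f₁, …, f_s⟩` is automatically nonzero. -/
def H1 (f : Fin s → MvPolynomial (Fin n) K) : Prop :=
  RingTheory.Sequence.IsWeaklyRegular (MvPolynomial (Fin n) K) (List.ofFn f)

/-- The hypothesis H2: the ideals `⟨f₁, …, f_i⟩` are weakly-`w`-ideals. -/
def H2 (w : MonomialOrder (Fin n)) (f : Fin s → MvPolynomial (Fin n) K) : Prop :=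
  ∀ i : Fin s, IsWeaklyW w (Ideal.span (f '' {j | j ≤ i}))

/-! ### The matrices

A matrix whose columns are indexed by the monomials of degree `d` is represented by the list of its
rows, a row being the homogeneous polynomial of degree `d` with these coefficients. -/

/-- The columns of the matrices of degree `d`: the monomials of degree `d`, decreasing for `w`. -/
noncomputable def columns (w : MonomialOrder (Fin n)) (d : ℕ) : List (Fin n →₀ ℕ) :=
  ((((Finset.univ : Finset (Fin n)).finsuppAntidiag d).map w.toSyn.toEquiv.toEmbedding).sort
    (· ≥ ·)).map w.toSyn.symm

/-- Injective matrix in row-echelon form, up to permutation of the rows: the rows are nonzero, and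
their first nonzero entries (at their leading monomials) lie in pairwise distinct columns. -/
def IsInjectiveEchelon (w : MonomialOrder (Fin n)) (rows : List (MvPolynomial (Fin n) K)) : Prop :=
  (∀ r ∈ rows, r ≠ 0) ∧ (rows.map w.degree).Nodup

/-- Gaussian elimination up to the first column without nonzero pivot.
`PartialEchelon v cols rows pivots rest`: running it on the matrix with rows `rows`, through the
columns `cols`, can produce the pivot rows `pivots` and the remaining rows `rest`. In every column
the pivot is an entry of smallest valuation (that is, of largest value of the multiplicative `v`)
among the rows not yet used as pivot rows; ties may be broken in any way. -/
inductive PartialEchelon {Γ₀ : Type*} [LinearOrderedCommGroupWithZero Γ₀] (v : Valuation K Γ₀) :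
    List (Fin n →₀ ℕ) → List (MvPolynomial (Fin n) K) → List (MvPolynomial (Fin n) K) →
      List (MvPolynomial (Fin n) K) → Prop
  | done (rows : List (MvPolynomial (Fin n) K)) : PartialEchelon v [] rows [] rows
  | noPivot (c : Fin n →₀ ℕ) (cols : List (Fin n →₀ ℕ)) (rows : List (MvPolynomial (Fin n) K))
      (h : ∀ r ∈ rows, r.coeff c = 0) : PartialEchelon v (c :: cols) rows [] rows
  | pivot (c : Fin n →₀ ℕ) (cols : List (Fin n →₀ ℕ))
      (rows others pivots rest : List (MvPolynomial (Fin n) K)) (p : MvPolynomial (Fin n) K)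
      (hperm : rows.Perm (p :: others)) (hp : p.coeff c ≠ 0)
      (hmin : ∀ q ∈ others, v (q.coeff c) ≤ v (p.coeff c))
      (hrec : PartialEchelon v cols
        (others.map fun q => q - MvPolynomial.C (q.coeff c / p.coeff c) * p) pivots rest) :
      PartialEchelon v (c :: cols) rows (p :: pivots) rest

/-! ### The algorithm -/

/-- The memory of the algorithm. `mac d i` is the matrix `M_{d,i}`, `red d i` is the matrix
`M~_{d,i}` (where `0 ≤ i ≤ s`, and a matrix not computed yet is empty), `basis` is `G`. -/
structure State (K : Type*) [Field K] (n : ℕ) where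
  mac : ℕ → ℕ → List (MvPolynomial (Fin n) K)
  red : ℕ → ℕ → List (MvPolynomial (Fin n) K)
  basis : List (MvPolynomial (Fin n) K)

/-- All matrices and `G` are empty. -/
def State.init (K : Type*) [Field K] (n : ℕ) : State K n where
  mac _ _ := []
  red _ _ := []
  basis := []

open Classical in
/-- The rows `x^α f` with `|α| + e = d` such that `x^α` is not the leading monomial of a row of
`M~_{d-e,i}`, where `f` is the polynomial of index `i + 1` and `e` is its degree. -/
noncomputable def newRows (w : MonomialOrder (Fin n)) (S : State K n) (d i e : ℕ)
    (f : MvPolynomial (Fin n) K) : List (MvPolynomial (Fin n) K) :=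
  if e ≤ d then
    ((columns w (d - e)).filter fun α => ¬ ∃ r ∈ S.red (d - e) i, IsLM w r α).map
      fun α => MvPolynomial.monomial α 1 * f
  else []

/-- The matrix `M_{d,i+1}`: the new rows are added either to `M~_{d,i}` (`reuse = true`) or
to `M_{d,i}` (`reuse = false`). -/
noncomputable def buildMatrix (w : MonomialOrder (Fin n)) (reuse : Bool) (S : State K n)
    (d i e : ℕ) (f : MvPolynomial (Fin n) K) : List (MvPolynomial (Fin n) K) :=
  (if reuse then S.red d i else S.mac d i) ++ newRows w S d i e f

/-- The products of a variable by a row of `M~_{d-1,i}`. -/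
noncomputable def multiples (S : State K n) : ℕ → ℕ → List (MvPolynomial (Fin n) K)
  | 0, _ => []
  | d + 1, i => (List.finRange n).flatMap fun k => (S.red d i).map fun r => MvPolynomial.X k * r

/-- `T` is a choice of multiples that can replace the remaining rows `rest`, so that the pivot rows
and `T` together form an injective matrix in row-echelon form. -/
def IsCompletion (w : MonomialOrder (Fin n)) (mult pivots rest T : List (MvPolynomial (Fin n) K)) :
    Prop :=
  T.length = rest.length ∧ (∀ t ∈ T, t ∈ mult) ∧ IsInjectiveEchelon w (pivots ++ T)

open Classical in
/-- The memory after `M_{d,i+1}` and `M~_{d,i+1}` have been computed: they are stored, and the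
rows of `M~_{d,i+1}` whose leading monomial is not yet one of those of `G` are added to `G`. -/
noncomputable def State.store (w : MonomialOrder (Fin n)) (S : State K n) (d i : ℕ)
    (M R : List (MvPolynomial (Fin n) K)) : State K n where
  mac := Function.update S.mac d (Function.update (S.mac d) (i + 1) M)
  red := Function.update S.red d (Function.update (S.red d) (i + 1) R)
  basis := S.basis ++ R.filter fun r => ¬ ∃ g ∈ S.basis, w.degree g = w.degree r

/-- The body of the loops, for the degree `d` and the polynomial of index `i` (counted from `0`).
The result `none` means that an error is raised. -/
inductive Step {Γ₀ : Type*} [LinearOrderedCommGroupWithZero Γ₀] (v : Valuation K Γ₀)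
    (w : MonomialOrder (Fin n)) (reuse : Bool) (f : Fin s → MvPolynomial (Fin n) K)
    (deg : Fin s → ℕ) (d : ℕ) (i : Fin s) (S : State K n) : Option (State K n) → Prop
  | success (pivots rest T : List (MvPolynomial (Fin n) K))
      (hech : PartialEchelon v (columns w d) (buildMatrix w reuse S d i (deg i) (f i)) pivots rest)
      (hT : IsCompletion w (multiples S d (i + 1)) pivots rest T) :
      Step v w reuse f deg d i S
        (some (S.store w d i (buildMatrix w reuse S d i (deg i) (f i)) (pivots ++ T)))
  | error (pivots rest : List (MvPolynomial (Fin n) K))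
      (hech : PartialEchelon v (columns w d) (buildMatrix w reuse S d i (deg i) (f i)) pivots rest)
      (hT : ¬ ∃ T, IsCompletion w (multiples S d (i + 1)) pivots rest T) :
      Step v w reuse f deg d i S none

/-- Execution of a loop over a list of indices, which is left as soon as an error is raised. -/
inductive Loop {ι σ : Type*} (step : ι → σ → Option σ → Prop) : List ι → σ → Option σ → Prop
  | nil (S : σ) : Loop step [] S (some S)
  | next (a : ι) (l : List ι) (S S' : σ) (out : Option σ) (h : step a S (some S'))
      (hl : Loop step l S' out) : Loop step (a :: l) S out
  | error (a : ι) (l : List ι) (S : σ) (h : step a S none) : Loop step (a :: l) S none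

/-- `Run v w reuse f deg D out`: the weak Matrix-F5 algorithm, with exact arithmetic, run on the
polynomials `f`, of degrees `deg`, up to degree `D`, can end with the result `out`, which is either
`some G` (the algorithm returns `G`) or `none` (it raises an error). The outer loop is over
`d = 0, …, D`, the inner one over the indices of the polynomials. -/
def Run {Γ₀ : Type*} [LinearOrderedCommGroupWithZero Γ₀] (v : Valuation K Γ₀)
    (w : MonomialOrder (Fin n)) (reuse : Bool) (f : Fin s → MvPolynomial (Fin n) K)
    (deg : Fin s → ℕ) (D : ℕ) (out : Option (List (MvPolynomial (Fin n) K))) : Prop :=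
  ∃ o : Option (State K n),
    Loop (fun a : ℕ × Fin s => Step v w reuse f deg a.1 a.2)
      ((List.range (D + 1)).product (List.finRange s)) (State.init K n) o ∧
    out = o.map State.basis

end

end WeakMF5

/-! Write I_i for the ideal of the first i polynomials (`prefixIdeal`) and (I_i)_d for its part of
degree d. By induction along the loop, M_{d,i} and M~_{d,i} both span (I_i)_d. The discarded
products lose nothing: A_e is the sum of (I_{i-1})_e and the span of the standard monomials of
degree e, and f_i (I_{i-1})_e already lies in I_{i-1} (`homPart_sup_span_of_le`).

A step succeeds exactly when two local conditions hold at (d,i).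

Rank: M_{d,i} has dim (I_{i-1})_d rows plus one for each standard monomial of degree d - d_i. This
equals dim (I_i)_d iff f_i is injective on (A/I_{i-1})_{d-d_i} (`RegularAt`,
`finrank_eq_length_iff`). A completed matrix has as many rows, independent and in (I_i)_d, so
success forces equality.

Leading monomials: the pivots occupy an initial segment of the columns, and the next column, if any,
is not in LM(I_i). A completing row X_k P never has a minimal element of LM(I_i) as leading
monomial. So after a success the minimal elements of degree d are pivot columns, and everything
above them is in LM(I_i): this is `WeaklyAt` (`IsCompletion.weaklyAt`). Conversely, under `WeaklyAt`
each leading monomial beyond the pivots is X_k times one of degree d - 1, so a row of M~_{d-1,i}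
supplies it (`exists_isCompletion`).

H1 and H2 are the conjunctions of these conditions over all (d,i). Under them no step fails; if one
fails at (d,i), no run up to degree d or more can succeed. Only row spaces and leading monomials
matter, so the result does not depend on the choices or the variant. -/

namespace WeakMF5

open MvPolynomial
open Module (finrank)

/-! ### Row spaces and leading monomials of echelon matrices. -/

section Echelon

variable {K : Type*} [Field K] {n : ℕ} {w : MonomialOrder (Fin n)}

/-- The row space of a matrix. -/
noncomputable def listSpan (l : List (MvPolynomial (Fin n) K)) : Submodule K (MvPolynomial (Fin n) K) :=
  Submodule.span K {p | p ∈ l}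

theorem mem_listSpan {l : List (MvPolynomial (Fin n) K)} {p : MvPolynomial (Fin n) K}
    (h : p ∈ l) : p ∈ listSpan l :=
  Submodule.subset_span h

theorem listSpan_le {l : List (MvPolynomial (Fin n) K)}
    {V : Submodule K (MvPolynomial (Fin n) K)} : listSpan l ≤ V ↔ ∀ p ∈ l, p ∈ V :=
  Submodule.span_le

theorem listSpan_nil : listSpan ([] : List (MvPolynomial (Fin n) K)) = ⊥ := by
  simp [listSpan]

theorem listSpan_append (l₁ l₂ : List (MvPolynomial (Fin n) K)) :
    listSpan (l₁ ++ l₂) = listSpan l₁ ⊔ listSpan l₂ := by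
  rw [listSpan, listSpan, listSpan, ← Submodule.span_union]
  congr 1
  ext p
  simp

theorem listSpan_cons (r : MvPolynomial (Fin n) K) (l : List (MvPolynomial (Fin n) K)) :
    listSpan (r :: l) = Submodule.span K {r} ⊔ listSpan l := by
  rw [listSpan, listSpan, ← Submodule.span_union]
  congr 1
  ext p
  simp

theorem listSpan_map (φ : MvPolynomial (Fin n) K →ₗ[K] MvPolynomial (Fin n) K)
    (l : List (MvPolynomial (Fin n) K)) : listSpan (l.map φ) = (listSpan l).map φ := by
  rw [listSpan, listSpan, Submodule.map_span]
  congr 1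
  ext p
  simp

instance (l : List (MvPolynomial (Fin n) K)) : FiniteDimensional K (listSpan l) :=
  FiniteDimensional.span_of_finite K l.finite_toSet

theorem finrank_listSpan_le (l : List (MvPolynomial (Fin n) K)) :
    finrank K (listSpan l) ≤ l.length := by
  induction l with
  | nil => simp [listSpan_nil]
  | cons r l ih =>
    rw [listSpan_cons, List.length_cons, add_comm]
    refine (Submodule.finrank_add_le_finrank_add_finrank _ _).trans (add_le_add ?_ ih)
    exact (finrank_span_le_card {r}).trans (by simp)

/-- Cancellation of the leading term. -/
theorem exists_degree_sub_smul_lt {p q : MvPolynomial (Fin n) K} (hq : q ≠ 0)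
    (h : w.degree q = w.degree p) :
    ∃ c : K, p - c • q = 0 ∨ w.toSyn (w.degree (p - c • q)) < w.toSyn (w.degree p) := by
  refine ⟨p.coeff (w.degree p) / q.coeff (w.degree p), or_iff_not_imp_left.2 fun h0 => ?_⟩
  have hq' : q.coeff (w.degree p) ≠ 0 := by
    rw [← h]; exact (w.coeff_degree_ne_zero_iff).2 hq
  refine lt_of_le_of_ne ((w.degree_sub_le).trans (sup_le le_rfl ?_)) fun he => ?_
  · rw [← h]; exact w.degree_smul_le
  · have h1 := (w.coeff_degree_ne_zero_iff).2 h0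
    rw [w.toSyn.injective he] at h1
    apply h1
    rw [coeff_sub, coeff_smul, smul_eq_mul, div_mul_cancel₀ _ hq', sub_self]

/-- If the leading monomials of the elements of `S` are all those of `V`, then `V ≤ span S`. -/
theorem le_span_of_degree {V : Submodule K (MvPolynomial (Fin n) K)}
    {S : Set (MvPolynomial (Fin n) K)} (hS : S ⊆ V)
    (h : ∀ p ∈ V, p ≠ 0 → ∃ r ∈ S, r ≠ 0 ∧ w.degree r = w.degree p) :
    V ≤ Submodule.span K S := by
  -- Induction on the leading monomial: a monomial order is a well-order, so `V` may have infinite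
  -- dimension.
  suffices H : ∀ a : w.syn, ∀ p ∈ V, w.toSyn (w.degree p) = a → p ∈ Submodule.span K S from
    fun p hp => H _ p hp rfl
  intro a
  induction a using WellFoundedLT.induction with
  | ind a ih =>
    rintro p hp rfl
    by_cases hp0 : p = 0
    · rw [hp0]; exact zero_mem _
    obtain ⟨r, hr, hr0, hd⟩ := h p hp hp0
    obtain ⟨c, hc⟩ := exists_degree_sub_smul_lt hr0 hd
    have hmem : c • r ∈ Submodule.span K S := Submodule.smul_mem _ _ (Submodule.subset_span hr)
    have : p - c • r ∈ Submodule.span K S := by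
      rcases hc with hc | hc
      · rw [hc]; exact zero_mem _
      · exact ih _ hc _ (sub_mem hp (V.smul_mem _ (hS hr))) rfl
    simpa using add_mem this hmem

theorem IsInjectiveEchelon.of_cons {r : MvPolynomial (Fin n) K}
    {l : List (MvPolynomial (Fin n) K)} (h : IsInjectiveEchelon w (r :: l)) :
    IsInjectiveEchelon w l :=
  ⟨fun p hp => h.1 p (List.mem_cons_of_mem _ hp), (List.nodup_cons.1 h.2).2⟩

theorem degree_smul_of_ne_zero {c : K} (hc : c ≠ 0) (p : MvPolynomial (Fin n) K) :
    w.degree (c • p) = w.degree p :=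
  w.degree_smul_of_isRegular (isRegular_iff_ne_zero.2 hc)

/-- The leading monomials of the row space of an echelon matrix are those of its rows. -/
theorem IsInjectiveEchelon.exists_degree_eq {l : List (MvPolynomial (Fin n) K)}
    (h : IsInjectiveEchelon w l) {p : MvPolynomial (Fin n) K} (hp : p ∈ listSpan l)
    (hp0 : p ≠ 0) : ∃ r ∈ l, w.degree r = w.degree p := by
  induction l generalizing p with
  | nil => rw [listSpan_nil, Submodule.mem_bot] at hp; exact absurd hp hp0
  | cons r l ih =>
    rw [listSpan_cons, Submodule.mem_sup] at hp
    obtain ⟨y, hy, q, hq, rfl⟩ := hp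
    obtain ⟨c, rfl⟩ := Submodule.mem_span_singleton.1 hy
    have ih' := fun hq0 => ih h.of_cons hq hq0
    by_cases hq0 : q = 0
    · refine ⟨r, List.mem_cons_self, ?_⟩
      have hc : c ≠ 0 := fun hc => hp0 (by simp [hc, hq0])
      rw [hq0, add_zero, degree_smul_of_ne_zero hc]
    obtain ⟨r', hr', hd⟩ := ih' hq0
    by_cases hc : c = 0
    · exact ⟨r', List.mem_cons_of_mem _ hr', by simpa [hc] using hd⟩
    -- Distinct leading monomials cannot cancel, so the larger one leads the sum.
    have hne : w.degree (c • r) ≠ w.degree q := by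
      rw [degree_smul_of_ne_zero hc, ← hd]
      intro he
      exact (List.nodup_cons.1 h.2).1 (he ▸ List.mem_map_of_mem hr')
    have hadd := w.degree_add_of_ne hne
    rcases le_total (w.toSyn (w.degree (c • r))) (w.toSyn (w.degree q)) with hle | hle
    · rw [sup_eq_right.2 hle] at hadd
      exact ⟨r', List.mem_cons_of_mem _ hr', hd.trans (w.toSyn.injective hadd).symm⟩
    · rw [sup_eq_left.2 hle] at hadd
      refine ⟨r, List.mem_cons_self, ?_⟩
      rw [w.toSyn.injective hadd, degree_smul_of_ne_zero hc]

theorem IsInjectiveEchelon.finrank_eq {l : List (MvPolynomial (Fin n) K)}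
    (h : IsInjectiveEchelon w l) : finrank K (listSpan l) = l.length := by
  induction l with
  | nil => simp [listSpan_nil]
  | cons r l ih =>
    have hr : r ≠ 0 := h.1 r List.mem_cons_self
    have hinf : Submodule.span K {r} ⊓ listSpan l = ⊥ := by
      rw [eq_bot_iff]
      rintro x ⟨hx, hxl⟩
      obtain ⟨c, rfl⟩ := Submodule.mem_span_singleton.1 hx
      by_contra hne
      have hc : c ≠ 0 := fun hc => hne (by simp [hc])
      obtain ⟨r', hr', hd⟩ := h.of_cons.exists_degree_eq hxl hne
      rw [degree_smul_of_ne_zero hc] at hd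
      exact (List.nodup_cons.1 h.2).1 (hd ▸ List.mem_map_of_mem hr')
    have := Submodule.finrank_sup_add_finrank_inf_eq (Submodule.span K {r}) (listSpan l)
    rw [hinf, finrank_bot, add_zero, ih h.of_cons, finrank_span_singleton hr] at this
    rw [listSpan_cons, this, List.length_cons, add_comm]

theorem IsInjectiveEchelon.listSpan_eq_of_length_le {l : List (MvPolynomial (Fin n) K)}
    (h : IsInjectiveEchelon w l) {V : Submodule K (MvPolynomial (Fin n) K)}
    [FiniteDimensional K V] (hl : ∀ r ∈ l, r ∈ V) (hV : finrank K V ≤ l.length) :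
    listSpan l = V :=
  Submodule.eq_of_le_of_finrank_le (listSpan_le.2 hl) (by rwa [h.finrank_eq])

end Echelon

/-- By the sum-intersection formula and rank-nullity, the left side falls short of the right by dim
(V ∩ φU) + dim ker φ|U, so equality means that both vanish. In the application φ is multiplication
by f_i and `U` is spanned by standard monomials. -/
theorem finrank_sup_map_eq_iff {K M : Type*} [Field K] [AddCommGroup M] [Module K M]
    (V U : Submodule K M) [FiniteDimensional K V] [FiniteDimensional K U] (φ : M →ₗ[K] M) :
    finrank K ↥(V ⊔ U.map φ) = finrank K V + finrank K U ↔ ∀ h ∈ U, φ h ∈ V → h = 0 := by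
  have h1 := Submodule.finrank_sup_add_finrank_inf_eq V (U.map φ)
  have h2 := (φ.domRestrict U).finrank_range_add_finrank_ker
  rw [LinearMap.range_domRestrict] at h2
  constructor
  · intro h x hx hxV
    have hi : finrank K ↥(V ⊓ U.map φ) = 0 := by omega
    have hk : finrank K (LinearMap.ker (φ.domRestrict U)) = 0 := by omega
    rw [Submodule.finrank_eq_zero] at hi hk
    have h0 : φ x = 0 := by
      have : φ x ∈ V ⊓ U.map φ := ⟨hxV, Submodule.mem_map_of_mem hx⟩
      rwa [hi, Submodule.mem_bot] at this
    have : (⟨x, hx⟩ : U) ∈ LinearMap.ker (φ.domRestrict U) := by simpa using h0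
    rw [hk, Submodule.mem_bot] at this
    exact congrArg Subtype.val this
  · intro h
    have hi : V ⊓ U.map φ = ⊥ := by
      rw [eq_bot_iff]
      rintro _ ⟨hxV, x, hx, rfl⟩
      simp [h x hx hxV]
    have hk : LinearMap.ker (φ.domRestrict U) = ⊥ := by
      rw [eq_bot_iff]
      rintro ⟨x, hx⟩ hx0
      have hx0 : φ x = 0 := by simpa using hx0
      simp [h x hx (by simp [hx0])]
    rw [hi, finrank_bot] at h1
    rw [hk, finrank_bot] at h2
    omega

/-! ### Graded parts of homogeneous ideals, standard monomials, regular sequences. -/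

section Ideals

variable {K : Type*} [Field K] {n s : ℕ} {w : MonomialOrder (Fin n)}

attribute [local instance] MvPolynomial.gradedAlgebra in
theorem homogeneousComponent_mul_of_le {f : MvPolynomial (Fin n) K} {e d : ℕ}
    (hf : f.IsHomogeneous e) (h : e ≤ d) (g : MvPolynomial (Fin n) K) :
    homogeneousComponent d (f * g) = f * homogeneousComponent (d - e) g := by
  rw [← decomposition.decompose'_apply, ← decomposition.decompose'_apply]
  exact DirectSum.coe_decompose_mul_of_left_mem_of_le (homogeneousSubmodule (Fin n) K) hf h

attribute [local instance] MvPolynomial.gradedAlgebra in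
theorem homogeneousComponent_mul_of_lt {f : MvPolynomial (Fin n) K} {e d : ℕ}
    (hf : f.IsHomogeneous e) (h : d < e) (g : MvPolynomial (Fin n) K) :
    homogeneousComponent d (f * g) = 0 := by
  rw [← decomposition.decompose'_apply]
  exact DirectSum.coe_decompose_mul_of_left_mem_of_not_le (homogeneousSubmodule (Fin n) K) hf
    (not_le.2 h)

/-- The ideal contains the homogeneous components of its elements. -/
def HasComponents (I : Ideal (MvPolynomial (Fin n) K)) : Prop :=
  ∀ p ∈ I, ∀ d, homogeneousComponent d p ∈ I

attribute [local instance] MvPolynomial.gradedAlgebra in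
theorem hasComponents_span {S : Set (MvPolynomial (Fin n) K)}
    (hS : ∀ p ∈ S, ∃ d, p.IsHomogeneous d) : HasComponents (Ideal.span S) := fun _ hp d =>
  homogeneousComponent_mem_of_mem
    (Ideal.homogeneous_span _ S fun p hp => (hS p hp).imp fun _ h => h) hp d

/-- The homogeneous part of degree `d` of an ideal. -/
noncomputable def homPart (I : Ideal (MvPolynomial (Fin n) K)) (d : ℕ) :
    Submodule K (MvPolynomial (Fin n) K) :=
  I.restrictScalars K ⊓ homogeneousSubmodule (Fin n) K d

instance (d : ℕ) : FiniteDimensional K (homogeneousSubmodule (Fin n) K d) :=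
  Module.Finite.iff_fg.2 (homogeneousSubmodule_fg _ _ d)

instance (I : Ideal (MvPolynomial (Fin n) K)) (d : ℕ) : FiniteDimensional K (homPart I d) :=
  Submodule.finiteDimensional_of_le inf_le_right

theorem degree_degree_eq {p : MvPolynomial (Fin n) K} {d : ℕ} (hp : p.IsHomogeneous d)
    (hp0 : p ≠ 0) : (w.degree p).degree = d := by
  by_contra h
  exact (w.coeff_degree_ne_zero_iff).2 hp0 (hp.coeff_eq_zero h)

/-- Leading monomials of degree `d` come from homogeneous elements. -/
theorem mem_LM_iff {I : Ideal (MvPolynomial (Fin n) K)} (hI : HasComponents I)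
    {α : Fin n →₀ ℕ} :
    α ∈ LM w I ↔ ∃ p ∈ homPart I α.degree, p ≠ 0 ∧ w.degree p = α := by
  constructor
  · rintro ⟨p, hp, hp0, rfl⟩
    -- The component of `p` in the degree of its leading monomial keeps this monomial and gains no
    -- other.
    have hc : (homogeneousComponent (w.degree p).degree p).coeff (w.degree p) ≠ 0 := by
      rw [coeff_homogeneousComponent, if_pos rfl]
      exact (w.coeff_degree_ne_zero_iff).2 hp0
    refine ⟨homogeneousComponent (w.degree p).degree p,
      ⟨hI p hp _, homogeneousComponent_isHomogeneous _ _⟩, ?_, ?_⟩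
    · intro h
      rw [h] at hc
      exact hc (coeff_zero _)
    · refine w.toSyn.injective (le_antisymm (w.degree_le_degree_of_support_subset ?_)
        (w.le_degree (mem_support_iff.2 hc)))
      rw [support_homogeneousComponent]
      exact Finset.filter_subset _ _
  · rintro ⟨p, hp, hp0, h⟩
    exact ⟨p, hp.1, hp0, h⟩

theorem degree_monomial_one (α : Fin n →₀ ℕ) : w.degree (monomial α (1 : K)) = α := by
  classical
  rw [w.degree_monomial, if_neg one_ne_zero]

theorem LM_upward {I : Ideal (MvPolynomial (Fin n) K)} {α β : Fin n →₀ ℕ} (hα : α ∈ LM w I)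
    (h : α ≤ β) : β ∈ LM w I := by
  obtain ⟨p, hp, hp0, rfl⟩ := hα
  have hm : monomial (β - w.degree p) (1 : K) ≠ 0 := by simp
  refine ⟨monomial (β - w.degree p) 1 * p, I.mul_mem_left _ hp, mul_ne_zero hm hp0, ?_⟩
  rw [w.degree_mul hm hp0, degree_monomial_one, tsub_add_cancel_of_le h]

theorem mem_columns {d : ℕ} {α : Fin n →₀ ℕ} : α ∈ columns w d ↔ α.degree = d := by
  simp only [columns, List.mem_map, Finset.mem_sort, Finset.mem_map, Finset.mem_finsuppAntidiag]
  constructor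
  · rintro ⟨a, ⟨b, ⟨hb, -⟩, rfl⟩, rfl⟩
    simpa [Finsupp.degree_eq_sum] using hb
  · intro h
    exact ⟨w.toSyn α, ⟨α, ⟨by simpa [Finsupp.degree_eq_sum] using h, Finset.subset_univ _⟩, rfl⟩,
      by simp⟩

theorem pairwise_columns (d : ℕ) :
    (columns w d).Pairwise fun a b => w.toSyn b < w.toSyn a := by
  rw [columns, List.pairwise_map]
  refine (Finset.sortedGT_sort _).pairwise.imp ?_
  intro a b h
  simpa using h

open Classical in
/-- The monomials of degree `e` which are not leading monomials of elements of `I`. -/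
noncomputable def stdMonomials (w : MonomialOrder (Fin n)) (I : Ideal (MvPolynomial (Fin n) K))
    (e : ℕ) : List (Fin n →₀ ℕ) :=
  (columns w e).filter fun α => α ∉ LM w I

theorem mem_stdMonomials {I : Ideal (MvPolynomial (Fin n) K)} {e : ℕ} {α : Fin n →₀ ℕ} :
    α ∈ stdMonomials w I e ↔ α.degree = e ∧ α ∉ LM w I := by
  simp [stdMonomials, mem_columns]

/-- The complement of `homPart I e` spanned by monomials. -/
noncomputable def stdSpan (w : MonomialOrder (Fin n)) (I : Ideal (MvPolynomial (Fin n) K))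
    (e : ℕ) : Submodule K (MvPolynomial (Fin n) K) :=
  listSpan ((stdMonomials w I e).map fun α => monomial α 1)

instance (I : Ideal (MvPolynomial (Fin n) K)) (e : ℕ) : FiniteDimensional K (stdSpan w I e) :=
  inferInstanceAs (FiniteDimensional K (listSpan _))

theorem echelon_monomials {l : List (Fin n →₀ ℕ)} (hl : l.Nodup) :
    IsInjectiveEchelon w (l.map fun α => monomial α (1 : K)) := by
  constructor
  · simp only [List.mem_map]
    rintro _ ⟨α, -, rfl⟩
    simp
  · rw [List.map_map]
    have : (w.degree ∘ fun α => monomial α (1 : K)) = id := by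
      funext α; exact degree_monomial_one α
    rwa [this, List.map_id]

theorem nodup_columns (d : ℕ) : (columns w d).Nodup :=
  (pairwise_columns d).imp fun h he => by simp [he] at h

theorem nodup_stdMonomials (I : Ideal (MvPolynomial (Fin n) K)) (e : ℕ) :
    (stdMonomials w I e).Nodup :=
  (nodup_columns e).filter _

theorem finrank_stdSpan (I : Ideal (MvPolynomial (Fin n) K)) (e : ℕ) :
    finrank K (stdSpan w I e) = (stdMonomials w I e).length := by
  rw [stdSpan, (echelon_monomials (w := w) (nodup_stdMonomials I e)).finrank_eq, List.length_map]

theorem stdSpan_le (I : Ideal (MvPolynomial (Fin n) K)) (e : ℕ) :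
    stdSpan w I e ≤ homogeneousSubmodule (Fin n) K e := by
  rw [stdSpan, listSpan_le]
  simp only [List.mem_map, mem_stdMonomials]
  rintro _ ⟨α, ⟨hα, -⟩, rfl⟩
  exact isHomogeneous_monomial _ hα

theorem eq_zero_of_mem_stdSpan {I : Ideal (MvPolynomial (Fin n) K)} {e : ℕ}
    {p : MvPolynomial (Fin n) K} (hp : p ∈ stdSpan w I e) (hpI : p ∈ I) : p = 0 := by
  by_contra hp0
  obtain ⟨r, hr, hd⟩ :=
    (echelon_monomials (w := w) (nodup_stdMonomials I e)).exists_degree_eq hp hp0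
  obtain ⟨α, hα, rfl⟩ := List.mem_map.1 hr
  rw [degree_monomial_one] at hd
  exact (mem_stdMonomials.1 hα).2 ⟨p, hpI, hp0, hd.symm⟩

/-- Macaulay's theorem in degree `e`: each monomial either leads a homogeneous element of `I` or is
itself standard, so `le_span_of_degree` applies. -/
theorem homPart_sup_stdSpan {I : Ideal (MvPolynomial (Fin n) K)} (hI : HasComponents I) (e : ℕ) :
    homPart I e ⊔ stdSpan w I e = homogeneousSubmodule (Fin n) K e := by
  refine le_antisymm (sup_le inf_le_right (stdSpan_le I e)) ?_
  have h := le_span_of_degree (w := w) (V := homogeneousSubmodule (Fin n) K e)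
    (S := (homPart I e : Set (MvPolynomial (Fin n) K)) ∪ stdSpan w I e)
    (Set.union_subset (fun p hp => hp.2) (stdSpan_le I e)) ?_
  · rwa [Submodule.span_union, Submodule.span_eq, Submodule.span_eq] at h
  intro p hp hp0
  have hd := degree_degree_eq (w := w) hp hp0
  by_cases h : w.degree p ∈ LM w I
  · obtain ⟨q, hq, hq0, hqd⟩ := (mem_LM_iff hI).1 h
    rw [hd] at hq
    exact ⟨q, Or.inl hq, hq0, hqd⟩
  · refine ⟨monomial (w.degree p) 1, Or.inr (mem_listSpan ?_), by simp, degree_monomial_one _⟩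
    exact List.mem_map_of_mem (mem_stdMonomials.2 ⟨hd, h⟩)

theorem homPart_sup_span_of_lt {I : Ideal (MvPolynomial (Fin n) K)} (hI : HasComponents I)
    {f : MvPolynomial (Fin n) K} {e d : ℕ} (hf : f.IsHomogeneous e) (h : d < e) :
    homPart (I ⊔ Ideal.span {f}) d = homPart I d := by
  refine le_antisymm ?_ (inf_le_inf_right _ fun p hp => Ideal.mem_sup_left hp)
  rintro p ⟨hp, hpd⟩
  refine ⟨?_, hpd⟩
  obtain ⟨a, ha, b, hb, rfl⟩ := Submodule.mem_sup.1 hp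
  obtain ⟨b, rfl⟩ := Ideal.mem_span_singleton.1 hb
  rw [← homogeneousComponent_eq_self hpd, map_add, homogeneousComponent_mul_of_lt hf h, add_zero]
  exact hI a ha d

/-- The F5 criterion: in a multiple f b, the part of the cofactor lying in `I` contributes an
element of `I`, so only its standard part is needed. -/
theorem homPart_sup_span_of_le {I : Ideal (MvPolynomial (Fin n) K)} (hI : HasComponents I)
    {f : MvPolynomial (Fin n) K} {e d : ℕ} (hf : f.IsHomogeneous e) (h : e ≤ d) :
    homPart (I ⊔ Ideal.span {f}) d =
      homPart I d ⊔ (stdSpan w I (d - e)).map (LinearMap.mulLeft K f) := by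
  refine le_antisymm ?_ (sup_le (inf_le_inf_right _ fun p hp => Ideal.mem_sup_left hp) ?_)
  · rintro p ⟨hp, hpd⟩
    obtain ⟨a, ha, b, hb, rfl⟩ := Submodule.mem_sup.1 hp
    obtain ⟨b, rfl⟩ := Ideal.mem_span_singleton.1 hb
    rw [← homogeneousComponent_eq_self hpd, map_add, homogeneousComponent_mul_of_le hf h]
    have hb := homogeneousComponent_mem (d - e) b
    rw [← homPart_sup_stdSpan (w := w) hI] at hb
    obtain ⟨x, hx, y, hy, hxy⟩ := Submodule.mem_sup.1 hb
    rw [← hxy, mul_add, ← add_assoc]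
    refine Submodule.add_mem_sup (add_mem ⟨hI a ha d, homogeneousComponent_isHomogeneous _ _⟩
      ⟨I.mul_mem_left _ hx.1, ?_⟩) (Submodule.mem_map_of_mem hy)
    have := hf.mul hx.2
    rwa [Nat.add_sub_cancel' h] at this
  · rintro _ ⟨y, hy, rfl⟩
    refine ⟨Ideal.mem_sup_right (Ideal.mul_mem_right _ _ (Ideal.mem_span_singleton_self f)), ?_⟩
    have := hf.mul (stdSpan_le _ _ hy)
    rwa [Nat.add_sub_cancel' h] at this

/-- The ideal generated by the first `i` polynomials. -/
noncomputable def prefixIdeal (f : Fin s → MvPolynomial (Fin n) K) (i : ℕ) : Ideal (MvPolynomial (Fin n) K) :=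
  Ideal.span (f '' {j | (j : ℕ) < i})

theorem prefixIdeal_zero (f : Fin s → MvPolynomial (Fin n) K) : prefixIdeal f 0 = ⊥ := by
  simp [prefixIdeal]

theorem prefixIdeal_length (f : Fin s → MvPolynomial (Fin n) K) :
    prefixIdeal f s = Ideal.span (Set.range f) := by
  rw [prefixIdeal, ← Set.image_univ]
  congr 2
  ext j
  simp

theorem prefixIdeal_le_range (f : Fin s → MvPolynomial (Fin n) K) (i : ℕ) :
    prefixIdeal f i ≤ Ideal.span (Set.range f) :=
  Ideal.span_mono (Set.image_subset_range _ _)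

theorem prefixIdeal_succ (f : Fin s → MvPolynomial (Fin n) K) (i : Fin s) :
    prefixIdeal f (i + 1) = prefixIdeal f i ⊔ Ideal.span {f i} := by
  rw [prefixIdeal, prefixIdeal, ← Ideal.span_union, ← Set.image_singleton, ← Set.image_union]
  congr 2
  ext j
  simp [le_iff_eq_or_lt, Fin.ext_iff]

theorem prefixIdeal_succ' (f : Fin s → MvPolynomial (Fin n) K) (i : Fin s) :
    prefixIdeal f (i + 1) = Ideal.span (f '' {j | j ≤ i}) := by
  rw [prefixIdeal]
  congr 2
  ext j
  simp

theorem hasComponents_prefixIdeal {f : Fin s → MvPolynomial (Fin n) K} {deg : Fin s → ℕ}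
    (hf : ∀ i, (f i).IsHomogeneous (deg i)) (i : ℕ) : HasComponents (prefixIdeal f i) := by
  refine hasComponents_span ?_
  rintro _ ⟨j, -, rfl⟩
  exact ⟨_, hf j⟩

theorem H1_iff (f : Fin s → MvPolynomial (Fin n) K) :
    H1 f ↔ ∀ i : Fin s, ∀ p, f i * p ∈ prefixIdeal f i → p ∈ prefixIdeal f i := by
  have key : ∀ i : Fin s,
      (Ideal.ofList ((List.ofFn f).take i) • ⊤ : Ideal (MvPolynomial (Fin n) K)) =
        prefixIdeal f i := by
    intro i
    rw [smul_eq_mul, Ideal.mul_top, Ideal.ofList, prefixIdeal]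
    congr 1
    ext p
    simp only [Set.mem_ofPred_eq, List.mem_take_iff_getElem, List.getElem_ofFn, Set.mem_image,
      List.length_ofFn]
    constructor
    · rintro ⟨j, hj, rfl⟩
      exact ⟨⟨j, by omega⟩, by simpa using (lt_min_iff.1 hj).1, rfl⟩
    · rintro ⟨j, hj, rfl⟩
      exact ⟨j, lt_min hj j.2, rfl⟩
  rw [H1, RingTheory.Sequence.isWeaklyRegular_iff]
  constructor
  · intro h i p hp
    have := h i (by simp)
    rw [isSMulRegular_iff_right_eq_zero_of_smul] at this
    have h2 := this (Submodule.Quotient.mk p)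
    rw [← Submodule.Quotient.mk_smul, Submodule.Quotient.mk_eq_zero,
      Submodule.Quotient.mk_eq_zero, key i, List.getElem_ofFn] at h2
    exact h2 hp
  · intro h i hi
    rw [List.length_ofFn] at hi
    rw [isSMulRegular_iff_right_eq_zero_of_smul]
    intro x
    obtain ⟨p, rfl⟩ := Submodule.Quotient.mk_surjective _ x
    rw [← Submodule.Quotient.mk_smul, Submodule.Quotient.mk_eq_zero,
      Submodule.Quotient.mk_eq_zero, key ⟨i, hi⟩, List.getElem_ofFn]
    exact h ⟨i, hi⟩ p

end Ideals

/-! ### Reduced Gröbner bases and minimal leading monomials. -/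

section ReducedBasis

variable {K : Type*} [Field K] {n : ℕ} {w : MonomialOrder (Fin n)}

/-- A minimal generator of the monomial ideal of leading monomials is the leading monomial of
a monic element of `I` with no other monomial in `LM I`. -/
theorem exists_reduced_element {I : Ideal (MvPolynomial (Fin n) K)} {α : Fin n →₀ ℕ}
    (hα : Minimal (· ∈ LM w I) α) :
    ∃ g ∈ I, w.degree g = α ∧ w.leadingCoeff g = 1 ∧
      ∀ γ ∈ g.support, γ ∈ LM w I → γ = α := by
  -- Divide x^α by all nonzero elements of `I` at once. No monomial of the remainder `r` is in
  -- LM(I), so x^α - r is the required element.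
  obtain ⟨q, r, h, -, hr⟩ := w.div_set (B := {p : MvPolynomial (Fin n) K | p ∈ I ∧ p ≠ 0})
    (fun b hb => ((w.leadingCoeff_ne_zero_iff).2 hb.2).isUnit) (monomial α 1)
  have hr' : ∀ γ ∈ r.support, γ ∉ LM w I := by
    rintro γ hγ ⟨p, hp, hp0, rfl⟩
    exact hr _ hγ p ⟨hp, hp0⟩ le_rfl
  have hαr : r.coeff α = 0 := by
    by_contra hne
    exact hr' α (mem_support_iff.2 hne) hα.prop
  have hgI : monomial α 1 - r ∈ I := by
    rw [h, add_sub_cancel_right, Finsupp.linearCombination_apply]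
    exact I.sum_mem fun b _ => I.mul_mem_left _ b.2.1
  have hgα : (monomial α 1 - r).coeff α = (1 : K) := by simp [hαr]
  have hg0 : monomial α 1 - r ≠ 0 := by
    intro h0
    rw [h0] at hgα
    simp at hgα
  have hsupp : ∀ γ ∈ (monomial α 1 - r).support, γ ∈ LM w I → γ = α := by
    intro γ hγ hγI
    by_contra hne
    have : r.coeff γ = 0 := by
      by_contra hc
      exact hr' γ (mem_support_iff.2 hc) hγI
    rw [mem_support_iff, coeff_sub, this, coeff_monomial, if_neg (Ne.symm hne)] at hγ
    simp at hγ
  have hdeg : w.degree (monomial α 1 - r) = α :=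
    hsupp _ (w.degree_mem_support hg0) ⟨_, hgI, hg0, rfl⟩
  refine ⟨_, hgI, hdeg, ?_, hsupp⟩
  rw [MonomialOrder.leadingCoeff, hdeg, hgα]

/-- `IsWeaklyW` quantifies over reduced Gröbner bases and would be vacuous if there were none. The
minimal leading monomials form an antichain, which is finite by Dickson's lemma. -/
theorem exists_isReducedGroebnerBasis (w : MonomialOrder (Fin n))
    (I : Ideal (MvPolynomial (Fin n) K)) :
    ∃ G, IsReducedGroebnerBasis w I G ∧
      ∀ α, Minimal (· ∈ LM w I) α → ∃ g ∈ G, w.degree g = α := by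
  classical
  have hfin : {α | Minimal (· ∈ LM w I) α}.Finite :=
    (setOfPred_minimal_antichain (· ∈ LM w I)).finite_of_partiallyWellOrderedOn
      (Set.isPWO_of_wellQuasiOrderedLE _)
  choose! g hgI hgd hgc hgs using
    fun (α : Fin n →₀ ℕ) (hα : Minimal (· ∈ LM w I) α) => exists_reduced_element hα
  refine ⟨hfin.toFinset.image g, ⟨⟨?_, ?_⟩, ?_, ?_⟩, ?_⟩
  · simp only [Finset.forall_mem_image, Set.Finite.mem_toFinset, Set.mem_ofPred_eq]
    exact hgI
  · intro p hp hp0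
    obtain ⟨α, hle, hα⟩ := exists_minimal_le_of_wellFoundedLT (· ∈ LM w I) (w.degree p)
      ⟨p, hp, hp0, rfl⟩
    refine ⟨g α, Finset.mem_image_of_mem _ (hfin.mem_toFinset.2 hα), ?_, ?_⟩
    · rw [← w.leadingCoeff_ne_zero_iff, hgc α hα]
      exact one_ne_zero
    · rwa [hgd α hα]
  · simp only [Finset.forall_mem_image, Set.Finite.mem_toFinset, Set.mem_ofPred_eq]
    exact hgc
  · simp only [Finset.forall_mem_image, Set.Finite.mem_toFinset, Set.mem_ofPred_eq]
    intro α hα β hβ hne γ hγ hle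
    rw [hgd β hβ] at hle
    have := hgs α hα γ hγ (LM_upward hβ.prop hle)
    rw [this] at hle
    exact hne (by rw [hα.eq_of_le hβ.prop hle])
  · intro α hα
    exact ⟨g α, Finset.mem_image_of_mem _ (hfin.mem_toFinset.2 hα), hgd α hα⟩

/-- A leading monomial below that of `g` is divisible by that of some element of `G`; by reducedness
this element can only be `g`. -/
theorem IsReducedGroebnerBasis.minimal {I : Ideal (MvPolynomial (Fin n) K)}
    {G : Finset (MvPolynomial (Fin n) K)} (hG : IsReducedGroebnerBasis w I G)
    {g : MvPolynomial (Fin n) K} (hg : g ∈ G) : Minimal (· ∈ LM w I) (w.degree g) := by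
  have hg0 : g ≠ 0 := by
    rw [← w.leadingCoeff_ne_zero_iff, hG.2.1 g hg]
    exact one_ne_zero
  refine ⟨⟨g, hG.1.1 g hg, hg0, rfl⟩, ?_⟩
  rintro _ ⟨p, hp, hp0, rfl⟩ hle
  obtain ⟨h, hh, hh0, hhd⟩ := hG.1.2 p hp hp0
  by_cases he : h = g
  · rwa [he] at hhd
  · exact absurd (hhd.trans hle) (hG.2.2 g hg h hh he _ (w.degree_mem_support hg0))

theorem isWeaklyW_iff {I : Ideal (MvPolynomial (Fin n) K)} :
    IsWeaklyW w I ↔ ∀ α, Minimal (· ∈ LM w I) α → ∀ β : Fin n →₀ ℕ, β.degree = α.degree →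
      w.toSyn α < w.toSyn β → β ∈ LM w I := by
  constructor
  · intro h α hα β hd hlt
    obtain ⟨G, hG, hGm⟩ := exists_isReducedGroebnerBasis w I
    obtain ⟨g, hg, rfl⟩ := hGm α hα
    exact h G hG g hg β hd hlt
  · intro h G hG g hg β hd hlt
    exact h _ (hG.minimal hg) β hd hlt

end ReducedBasis

/-! ### Gaussian elimination up to the first column without pivot. -/

section Elimination

variable {K : Type*} [Field K] {n : ℕ} {w : MonomialOrder (Fin n)}
  {Γ₀ : Type*} [LinearOrderedCommGroupWithZero Γ₀] {v : Valuation K Γ₀}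

/-- Gaussian elimination is always possible. -/
theorem exists_partialEchelon (v : Valuation K Γ₀) (cols : List (Fin n →₀ ℕ))
    (rows : List (MvPolynomial (Fin n) K)) :
    ∃ pivots rest, PartialEchelon v cols rows pivots rest := by
  induction cols generalizing rows with
  | nil => exact ⟨_, _, .done rows⟩
  | cons c cols ih =>
    classical
    by_cases h : ∀ r ∈ rows, r.coeff c = 0
    · exact ⟨_, _, .noPivot c cols rows h⟩
    push Not at h
    obtain ⟨r, hr, hrc⟩ := h
    obtain ⟨p, hp, hmax⟩ := rows.toFinset.exists_max_image (fun q => v (q.coeff c))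
      ⟨r, List.mem_toFinset.2 hr⟩
    simp only [List.mem_toFinset] at hp hmax
    -- The maximal value of `v` is at least that of a nonzero entry, hence positive.
    have hpc : p.coeff c ≠ 0 := by
      have := hmax r hr
      rw [← v.ne_zero_iff] at hrc ⊢
      exact (lt_of_lt_of_le (zero_lt_iff.2 hrc) this).ne'
    obtain ⟨pivots, rest, hrec⟩ :=
      ih ((rows.erase p).map fun q => q - C (q.coeff c / p.coeff c) * p)
    exact ⟨_, _, .pivot c cols rows _ _ _ p (List.perm_cons_erase hp) hpc
      (fun q hq => hmax q (List.mem_of_mem_erase hq)) hrec⟩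

theorem listSpan_perm {l₁ l₂ : List (MvPolynomial (Fin n) K)} (h : l₁.Perm l₂) :
    listSpan l₁ = listSpan l₂ := by
  rw [listSpan, listSpan]
  congr 1
  ext p
  exact h.mem_iff

theorem PartialEchelon.length_eq {cols : List (Fin n →₀ ℕ)}
    {rows pivots rest : List (MvPolynomial (Fin n) K)}
    (h : PartialEchelon v cols rows pivots rest) :
    pivots.length + rest.length = rows.length := by
  induction h with
  | done => simp
  | noPivot => simp
  | pivot c cols rows others pivots rest p hperm hp hmin hrec ih =>
    rw [hperm.length_eq, List.length_cons, List.length_cons]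
    rw [List.length_map] at ih
    omega

theorem listSpan_cons_map_sub (p : MvPolynomial (Fin n) K)
    (l : List (MvPolynomial (Fin n) K)) (a : MvPolynomial (Fin n) K → K) :
    listSpan (p :: l.map fun q => q - C (a q) * p) = listSpan (p :: l) := by
  refine le_antisymm (listSpan_le.2 ?_) (listSpan_le.2 ?_)
  · simp only [List.mem_cons, List.mem_map]
    rintro _ (rfl | ⟨q, hq, rfl⟩)
    · exact mem_listSpan List.mem_cons_self
    · rw [← smul_eq_C_mul]
      exact sub_mem (mem_listSpan (List.mem_cons_of_mem _ hq))
        (Submodule.smul_mem _ _ (mem_listSpan List.mem_cons_self))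
  · simp only [List.mem_cons]
    rintro q (rfl | hq)
    · exact mem_listSpan List.mem_cons_self
    · have h1 : q - C (a q) * p ∈ listSpan (p :: l.map fun q => q - C (a q) * p) :=
        mem_listSpan (List.mem_cons_of_mem _ (List.mem_map.2 ⟨q, hq, rfl⟩))
      have h2 : a q • p ∈ listSpan (p :: l.map fun q => q - C (a q) * p) :=
        Submodule.smul_mem _ _ (mem_listSpan List.mem_cons_self)
      rw [smul_eq_C_mul] at h2
      simpa using add_mem h1 h2

theorem PartialEchelon.listSpan_eq {cols : List (Fin n →₀ ℕ)}
    {rows pivots rest : List (MvPolynomial (Fin n) K)}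
    (h : PartialEchelon v cols rows pivots rest) :
    listSpan (pivots ++ rest) = listSpan rows := by
  induction h with
  | done => simp
  | noPivot => simp
  | pivot c cols rows others pivots rest p hperm hp hmin hrec ih =>
    rw [listSpan_perm hperm, ← listSpan_cons_map_sub p others fun q => q.coeff c / p.coeff c,
      List.cons_append, listSpan_cons, ih, ← listSpan_cons]

/-- The leading monomials of the pivot rows are the columns up to the first one without nonzero
pivot, and the remaining rows have nonzero entries only after this column. -/
theorem PartialEchelon.columns_eq {cols : List (Fin n →₀ ℕ)}
    {rows pivots rest : List (MvPolynomial (Fin n) K)}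
    (h : PartialEchelon v cols rows pivots rest)
    (hcols : cols.Pairwise fun a b => w.toSyn b < w.toSyn a)
    (hrows : ∀ r ∈ rows, ∀ γ ∈ r.support, γ ∈ cols) :
    (∀ p ∈ pivots, p ≠ 0) ∧ ∃ l, cols = pivots.map w.degree ++ l ∧
      ∀ r ∈ rest, ∀ γ ∈ r.support, γ ∈ l.tail := by
  induction h with
  -- Once the columns are exhausted, the remaining rows have empty support.
  | done rows => exact ⟨by simp, [], by simp, by simpa using hrows⟩
  | noPivot c cols rows h =>
    refine ⟨by simp, c :: cols, by simp, fun r hr γ hγ => ?_⟩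
    rcases List.mem_cons.1 (hrows r hr γ hγ) with rfl | h'
    · exact absurd (h r hr) (mem_support_iff.1 hγ)
    · exact h'
  | pivot c cols rows others pivots rest p hperm hp hmin hrec ih =>
    have hp0 : p ≠ 0 := fun h => hp (by simp [h])
    have hlt := (List.pairwise_cons.1 hcols).1
    have hpmem : p ∈ rows := hperm.mem_iff.2 List.mem_cons_self
    have hdeg : w.degree p = c := by
      refine w.toSyn.injective (le_antisymm (w.degree_le_iff.2 fun γ hγ => ?_)
        (w.le_degree (mem_support_iff.2 hp)))
      rcases List.mem_cons.1 (hrows p hpmem γ hγ) with rfl | h'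
      · exact le_rfl
      · exact (hlt γ h').le
    obtain ⟨h1, l, hl, h2⟩ := ih (List.pairwise_cons.1 hcols).2 (by
      simp only [List.mem_map]
      rintro _ ⟨q, hq, rfl⟩ γ hγ
      have hγc : γ ∈ c :: cols := by
        by_contra hγc
        have hz : ∀ r ∈ rows, r.coeff γ = 0 := fun r hr => by
          by_contra hne
          exact hγc (hrows r hr γ (mem_support_iff.2 hne))
        rw [mem_support_iff, coeff_sub, coeff_C_mul, hz p hpmem,
          hz q (hperm.mem_iff.2 (List.mem_cons_of_mem _ hq))] at hγ
        simp at hγ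
      rcases List.mem_cons.1 hγc with rfl | h'
      · rw [mem_support_iff, coeff_sub, coeff_C_mul, div_mul_cancel₀ _ hp, sub_self] at hγ
        exact absurd rfl hγ
      · exact h')
    exact ⟨by simpa [hp0] using h1, l, by simp [hdeg, hl], h2⟩

end Elimination

/-! ### Local conditions in one degree and the possibility of the completion. -/

section OneStep

variable {K : Type*} [Field K] {n s : ℕ} {w : MonomialOrder (Fin n)}
  {Γ₀ : Type*} [LinearOrderedCommGroupWithZero Γ₀] {v : Valuation K Γ₀}

/-- `H1` for the polynomial of index `i` in degree `d`. -/
def RegularAt (f : Fin s → MvPolynomial (Fin n) K) (deg : Fin s → ℕ) (d : ℕ) (i : Fin s) : Prop :=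
  deg i ≤ d → ∀ p : MvPolynomial (Fin n) K, p.IsHomogeneous (d - deg i) →
    f i * p ∈ prefixIdeal f i → p ∈ prefixIdeal f i

/-- The ideals are homogeneous and multiplication by `f i` shifts degrees, so injectivity can be
tested on components; the one of degree e is tested at d = e + `deg i`. -/
theorem H1_iff_regularAt {f : Fin s → MvPolynomial (Fin n) K} {deg : Fin s → ℕ}
    (hf : ∀ i, (f i).IsHomogeneous (deg i)) : H1 f ↔ ∀ d i, RegularAt f deg d i := by
  rw [H1_iff]
  refine ⟨fun h d i _ p _ hp => h i p hp, fun h i p hp => ?_⟩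
  rw [← sum_homogeneousComponent p]
  refine Ideal.sum_mem _ fun e _ => h (e + deg i) i (Nat.le_add_left _ _) _ ?_ ?_
  · rw [Nat.add_sub_cancel]
    exact homogeneousComponent_isHomogeneous _ _
  · have := hasComponents_prefixIdeal hf i _ hp (e + deg i)
    rwa [homogeneousComponent_mul_of_le (hf i) (Nat.le_add_left _ _), Nat.add_sub_cancel] at this

/-- The ideal `I` satisfies the condition of weakly-`w`-ideals in degree `d`. -/
def WeaklyAt (w : MonomialOrder (Fin n)) (I : Ideal (MvPolynomial (Fin n) K)) (d : ℕ) : Prop :=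
  ∀ α, Minimal (· ∈ LM w I) α → α.degree = d → ∀ β : Fin n →₀ ℕ, β.degree = d →
    w.toSyn α < w.toSyn β → β ∈ LM w I

theorem H2_iff_weaklyAt {f : Fin s → MvPolynomial (Fin n) K} :
    H2 w f ↔ ∀ d, ∀ i : Fin s, WeaklyAt w (prefixIdeal f (i + 1)) d := by
  simp only [H2, ← prefixIdeal_succ', isWeaklyW_iff, WeaklyAt]
  refine ⟨fun h d i α hα hd β hβ => h i α hα β (hβ.trans hd.symm), fun h i α hα β hβ =>
    h _ i α hα rfl β hβ⟩

/-- An echelon basis of the homogeneous part of `I` has all leading monomials of this degree. -/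
theorem exists_mem_degree_eq {I : Ideal (MvPolynomial (Fin n) K)} (hI : HasComponents I) {d : ℕ}
    {R : List (MvPolynomial (Fin n) K)} (hR : IsInjectiveEchelon w R)
    (hs : listSpan R = homPart I d) {α : Fin n →₀ ℕ} (hd : α.degree = d) (hα : α ∈ LM w I) :
    ∃ r ∈ R, w.degree r = α := by
  obtain ⟨p, hp, hp0, rfl⟩ := (mem_LM_iff hI).1 hα
  rw [hd, ← hs] at hp
  exact hR.exists_degree_eq hp hp0

theorem mem_homPart_of_mem {I : Ideal (MvPolynomial (Fin n) K)} {d : ℕ}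
    {R : List (MvPolynomial (Fin n) K)} (hs : listSpan R = homPart I d)
    {r : MvPolynomial (Fin n) K} (hr : r ∈ R) : r ∈ homPart I d :=
  hs ▸ mem_listSpan hr

-- One homogeneous element of `I` chosen for each leading monomial of degree `d` gives an echelon
-- basis.
open Classical in
theorem finrank_homPart {I : Ideal (MvPolynomial (Fin n) K)} (hI : HasComponents I) (d : ℕ) :
    finrank K (homPart I d) = ((columns w d).filter (· ∈ LM w I)).length := by
  choose! p hp hp0 hpd using fun (α : Fin n →₀ ℕ) (hα : α ∈ LM w I) => (mem_LM_iff hI).1 hα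
  have hmem : ∀ α ∈ (columns w d).filter (· ∈ LM w I), α ∈ LM w I ∧ α.degree = d := by
    simp only [List.mem_filter, mem_columns, decide_eq_true_eq]
    exact fun α h => h.symm
  have hdeg : (((columns w d).filter (· ∈ LM w I)).map p).map w.degree =
      (columns w d).filter (· ∈ LM w I) := by
    rw [List.map_map]
    conv_rhs => rw [← List.map_id ((columns w d).filter (· ∈ LM w I))]
    exact List.map_congr_left fun α hα => hpd α (hmem α hα).1
  have hech : IsInjectiveEchelon w (((columns w d).filter (· ∈ LM w I)).map p) := by
    refine ⟨?_, by rw [hdeg]; exact (nodup_columns d).filter _⟩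
    simp only [List.mem_map]
    rintro _ ⟨α, hα, rfl⟩
    exact hp0 α (hmem α hα).1
  have hspan : listSpan (((columns w d).filter (· ∈ LM w I)).map p) = homPart I d := by
    have hsub : ∀ r ∈ ((columns w d).filter (· ∈ LM w I)).map p, r ∈ homPart I d := by
      simp only [List.mem_map]
      rintro _ ⟨α, hα, rfl⟩
      have := hp α (hmem α hα).1
      rwa [(hmem α hα).2] at this
    refine le_antisymm (listSpan_le.2 hsub) (le_span_of_degree (w := w) hsub fun q hq hq0 => ?_)
    have hqI : w.degree q ∈ LM w I := ⟨q, hq.1, hq0, rfl⟩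
    refine ⟨p (w.degree q), List.mem_map_of_mem ?_, hp0 _ hqI, hpd _ hqI⟩
    simp only [List.mem_filter, mem_columns, decide_eq_true_eq]
    exact ⟨degree_degree_eq hq.2 hq0, hqI⟩
  rw [← hspan, hech.finrank_eq, List.length_map]

theorem support_of_mem_homPart {I : Ideal (MvPolynomial (Fin n) K)} {d : ℕ}
    {r : MvPolynomial (Fin n) K} (hr : r ∈ homPart I d) : ∀ γ ∈ r.support, γ ∈ columns w d := by
  intro γ hγ
  rw [mem_columns]
  by_contra h
  exact mem_support_iff.1 hγ (hr.2.coeff_eq_zero h)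

variable {I : Ideal (MvPolynomial (Fin n) K)} {d : ℕ}
  {M pivots rest T mult : List (MvPolynomial (Fin n) K)}

theorem PartialEchelon.pivots_mem (hech : PartialEchelon v (columns w d) M pivots rest)
    (hM : listSpan M = homPart I d) : ∀ p ∈ pivots, p ∈ homPart I d := fun p hp => by
  rw [← hM, ← hech.listSpan_eq]
  exact mem_listSpan (List.mem_append_left _ hp)

/-- A completed matrix is a basis of the homogeneous part of the ideal, and so is the matrix
before elimination. -/
theorem IsCompletion.listSpan_eq (hech : PartialEchelon v (columns w d) M pivots rest)
    (hT : IsCompletion w mult pivots rest T) (hM : listSpan M = homPart I d)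
    (hmult : ∀ t ∈ mult, t ∈ homPart I d) :
    listSpan (pivots ++ T) = homPart I d ∧ (pivots ++ T).length = M.length ∧
      finrank K (homPart I d) = M.length := by
  have hlen : (pivots ++ T).length = M.length := by
    rw [List.length_append, hT.1, hech.length_eq]
  -- `M` spans, so the dimension is at most its number of rows; the completed matrix has that many
  -- independent rows in the same space.
  have hs : listSpan (pivots ++ T) = homPart I d := by
    refine hT.2.2.listSpan_eq_of_length_le ?_ ?_
    · intro r hr
      rcases List.mem_append.1 hr with h | h
      · exact hech.pivots_mem hM r h
      · exact hmult r (hT.2.1 r h)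
    · rw [hlen, ← hM]
      exact finrank_listSpan_le M
  exact ⟨hs, hlen, by rw [← hs, hT.2.2.finrank_eq, hlen]⟩

theorem IsCompletion.weaklyAt (hI : HasComponents I)
    (hech : PartialEchelon v (columns w d) M pivots rest)
    (hT : IsCompletion w mult pivots rest T) (hM : listSpan M = homPart I d)
    (hmult : ∀ t ∈ mult, t ∈ homPart I d)
    (hX : ∀ t ∈ mult, ∃ k, ∃ p ∈ I, t = X k * p) : WeaklyAt w I d := by
  intro α hα hαd β hβd hlt
  by_contra hβ
  have hs := (hT.listSpan_eq hech hM hmult).1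
  obtain ⟨hp0, l, hl, -⟩ := hech.columns_eq (pairwise_columns d)
    fun r hr => support_of_mem_homPart (mem_homPart_of_mem hM hr)
  obtain ⟨r, hr, hrα⟩ := exists_mem_degree_eq hI hT.2.2 hs hαd hα.prop
  rcases List.mem_append.1 hr with h | h
  -- If α leads a pivot row, the larger monomial β stands in an earlier column, which is then a
  -- pivot column too.
  · have hpw := pairwise_columns (w := w) d
    rw [hl, List.pairwise_append] at hpw
    have hβc : β ∈ columns w d := mem_columns.2 hβd
    rw [hl, List.mem_append] at hβc
    rcases hβc with hβc | hβc
    · obtain ⟨p, hp, rfl⟩ := List.mem_map.1 hβc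
      exact hβ ⟨p, (hech.pivots_mem hM p hp).1, hp0 p hp, rfl⟩
    · have := hpw.2.2 _ (List.mem_map_of_mem h) _ hβc
      rw [hrα] at this
      exact lt_asymm this hlt
  -- If α leads a completing row, it is a variable times an element of LM(I), against minimality.
  · have hr0 := hT.2.2.1 r hr
    obtain ⟨k, p, hp, rfl⟩ := hX r (hT.2.1 r h)
    have hpn : p ≠ 0 := right_ne_zero_of_mul hr0
    rw [w.degree_mul (left_ne_zero_of_mul hr0) hpn, w.degree_X] at hrα
    have hle : w.degree p ≤ α := hrα ▸ le_add_self
    have := hα.eq_of_le ⟨p, hp, hpn, rfl⟩ hle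
    rw [← this] at hrα
    simp at hrα

theorem coeff_eq_zero_of_mem_listSpan {R : List (MvPolynomial (Fin n) K)} {γ : Fin n →₀ ℕ}
    (hR : ∀ r ∈ R, r.coeff γ = 0) {p : MvPolynomial (Fin n) K} (hp : p ∈ listSpan R) :
    p.coeff γ = 0 := by
  have : listSpan R ≤ LinearMap.ker (lcoeff K γ) := listSpan_le.2 fun r hr => by
    simpa using hR r hr
  simpa using this hp

/-- The first column without nonzero pivot is not a leading monomial of the ideal. -/
theorem PartialEchelon.notMem_LM (hI : HasComponents I)
    (hech : PartialEchelon v (columns w d) M pivots rest) (hM : listSpan M = homPart I d)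
    {c : Fin n →₀ ℕ} {l : List (Fin n →₀ ℕ)}
    (hl : columns w d = pivots.map w.degree ++ c :: l) (hp0 : ∀ p ∈ pivots, p ≠ 0)
    (hrest : ∀ r ∈ rest, ∀ γ ∈ r.support, γ ∈ l) : c ∉ LM w I := by
  intro hc
  have hpw := pairwise_columns (w := w) d
  have hnd := nodup_columns (w := w) d
  have hcd : c.degree = d := mem_columns.1 (by rw [hl]; simp)
  rw [hl, List.pairwise_append, List.pairwise_cons] at hpw
  rw [hl, List.nodup_append] at hnd
  obtain ⟨p, hp, hpne, rfl⟩ := (mem_LM_iff hI).1 hc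
  rw [hcd, ← hM, ← hech.listSpan_eq, listSpan_append] at hp
  -- `a` comes from the pivot rows, `b` from the others, supported after c. If `a = 0`, the leading
  -- monomial is below c; otherwise the leading term of `a` survives and lies above c.
  obtain ⟨a, ha, b, hb, rfl⟩ := Submodule.mem_sup.1 hp
  have hb0 : ∀ γ, γ ∉ l → b.coeff γ = 0 := fun γ hγ =>
    coeff_eq_zero_of_mem_listSpan (fun r hr => by
      by_contra hne
      exact hγ (hrest r hr γ (mem_support_iff.2 hne))) hb
  by_cases ha0 : a = 0
  · rw [ha0, zero_add] at hpw hpne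
    have h1 : b.coeff (w.degree b) = 0 := hb0 _ fun h => lt_irrefl _ (hpw.2.1.1 _ h)
    exact hpne ((w.coeff_degree_eq_zero_iff).1 h1)
  · obtain ⟨r, hr, hrd⟩ := IsInjectiveEchelon.exists_degree_eq (w := w) ⟨hp0, hnd.1⟩ ha ha0
    have hmem : w.degree a ∈ pivots.map w.degree := hrd ▸ List.mem_map_of_mem hr
    have hlt := hpw.2.2 _ hmem _ List.mem_cons_self
    have h1 : (a + b).coeff (w.degree a) ≠ 0 := by
      rw [coeff_add, hb0, add_zero]
      · exact (w.coeff_degree_ne_zero_iff).2 ha0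
      · intro h
        exact lt_irrefl _ (hpw.2.2 _ hmem _ (List.mem_cons_of_mem _ h))
    exact absurd (w.le_degree (mem_support_iff.2 h1)) (not_le.2 hlt)

/-- The completion is possible if the rows are linearly independent and the ideal satisfies the
condition of weakly-`w`-ideals. -/
theorem exists_isCompletion (hI : HasComponents I)
    (hech : PartialEchelon v (columns w d) M pivots rest) (hM : listSpan M = homPart I d)
    (hrank : finrank K (homPart I d) = M.length) (hw : WeaklyAt w I d)
    (hmult : ∀ δ ∈ LM w I, δ.degree + 1 = d → ∀ k, ∃ t ∈ mult, t ≠ 0 ∧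
      w.degree t = δ + Finsupp.single k 1) :
    ∃ T, IsCompletion w mult pivots rest T := by
  classical
  obtain ⟨hp0, l, hl, hrest⟩ := hech.columns_eq (pairwise_columns d)
    fun r hr => support_of_mem_homPart (mem_homPart_of_mem hM hr)
  have hpiv : ∀ α ∈ pivots.map w.degree, α ∈ LM w I := by
    simp only [List.mem_map]
    rintro _ ⟨p, hp, rfl⟩
    exact ⟨p, (hech.pivots_mem hM p hp).1, hp0 p hp, rfl⟩
  have ht : ∀ α ∈ l.filter (· ∈ LM w I), ∃ t ∈ mult, t ≠ 0 ∧ w.degree t = α := by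
    simp only [List.mem_filter, decide_eq_true_eq]
    rintro α ⟨hαl, hα⟩
    have hαd : α.degree = d := mem_columns.1 (hl ▸ List.mem_append_right _ hαl)
    -- The first column of `l` is not in LM(I), while a minimal α further on would put it there by
    -- `hw`.
    have hnot : ¬ Minimal (· ∈ LM w I) α := by
      intro hmin
      obtain ⟨c, l, rfl⟩ := List.exists_cons_of_ne_nil (List.ne_nil_of_mem hαl)
      have hc := hech.notMem_LM hI hM hl hp0 hrest
      have hpw := pairwise_columns (w := w) d
      rw [hl, List.pairwise_append, List.pairwise_cons] at hpw
      rcases List.mem_cons.1 hαl with rfl | hαl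
      · exact hc hα
      · exact hc (hw α hmin hαd c (mem_columns.1 (by rw [hl]; simp)) (hpw.2.1.1 α hαl))
    -- A proper divisor x^γ has a smaller exponent at some `k`; it still divides x^α / X_k, which is
    -- therefore in LM(I).
    obtain ⟨γ, hγα, hγ⟩ := (not_minimal_iff_exists_lt hα).1 hnot
    obtain ⟨hle, k, hk⟩ := Finsupp.lt_def.1 hγα
    have hα' : α - Finsupp.single k 1 + Finsupp.single k 1 = α :=
      tsub_add_cancel_of_le (Finsupp.single_le_iff.2 (by omega))
    have hγ' : γ ≤ α - Finsupp.single k 1 := by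
      intro j
      have := hle j
      rw [Finsupp.tsub_apply, Finsupp.single_apply]
      split_ifs with hj
      · subst hj; omega
      · simpa using this
    have hdeg := congrArg Finsupp.degree hα'
    rw [map_add, Finsupp.degree_single, hαd] at hdeg
    obtain ⟨t, htm, ht0, htd⟩ := hmult _ (LM_upward hγ hγ') hdeg k
    exact ⟨t, htm, ht0, htd.trans hα'⟩
  choose! t htm ht0 htd using ht
  have hdeg : ((l.filter (· ∈ LM w I)).map t).map w.degree = l.filter (· ∈ LM w I) := by
    rw [List.map_map]
    conv_rhs => rw [← List.map_id (l.filter (· ∈ LM w I))]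
    exact List.map_congr_left fun α hα => htd α hα
  refine ⟨(l.filter (· ∈ LM w I)).map t, ?_, ?_, ?_, ?_⟩
  -- All pivot columns are in LM(I), so by the rank hypothesis the other leading monomials are as
  -- many as the rows of `rest`.
  · have h1 := hech.length_eq
    rw [finrank_homPart (w := w) hI, hl, List.filter_append, List.length_append,
      List.filter_eq_self.2 (by simpa using hpiv), List.length_map] at hrank
    rw [List.length_map]
    omega
  · intro x hx
    obtain ⟨α, hα, rfl⟩ := List.mem_map.1 hx
    exact htm α hα
  · intro x hx
    rcases List.mem_append.1 hx with hx | hx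
    · exact hp0 x hx
    · obtain ⟨α, hα, rfl⟩ := List.mem_map.1 hx
      exact ht0 α hα
  · rw [List.map_append, hdeg]
    have := nodup_columns (w := w) d
    rw [hl] at this
    exact this.sublist ((List.Sublist.refl _).append List.filter_sublist)

end OneStep

/-! ### Bases computed by one pass of the loop body. -/

section Run

variable {K : Type*} [Field K] {n s : ℕ} {w : MonomialOrder (Fin n)}
  {Γ₀ : Type*} [LinearOrderedCommGroupWithZero Γ₀] {v : Valuation K Γ₀}
  {f : Fin s → MvPolynomial (Fin n) K} {deg : Fin s → ℕ} {reuse : Bool}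

/-- The rows of `M` and of `R` are bases of the homogeneous part of degree `d` of the ideal generated
by the first `i` polynomials, and `R` is in row-echelon form. -/
structure Computed (w : MonomialOrder (Fin n)) (f : Fin s → MvPolynomial (Fin n) K) (d i : ℕ)
    (M R : List (MvPolynomial (Fin n) K)) : Prop where
  echelon : IsInjectiveEchelon w R
  red_span : listSpan R = homPart (prefixIdeal f i) d
  mac_span : listSpan M = homPart (prefixIdeal f i) d
  length_eq : M.length = R.length

theorem Computed.finrank_eq {d i : ℕ} {M R : List (MvPolynomial (Fin n) K)}
    (h : Computed w f d i M R) : finrank K (homPart (prefixIdeal f i) d) = R.length := by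
  rw [← h.red_span, h.echelon.finrank_eq]

theorem computed_nil (d : ℕ) : Computed w f d 0 [] [] := by
  have : homPart (prefixIdeal f 0) d = ⊥ := by
    rw [prefixIdeal_zero, eq_bot_iff]
    exact fun p hp => hp.1
  exact ⟨⟨by simp, by simp⟩, by rw [this, listSpan_nil], by rw [this, listSpan_nil], rfl⟩

/-- The state contains the matrices used to compute those of index `i` in degree `d`. -/
structure Ready (w : MonomialOrder (Fin n)) (f : Fin s → MvPolynomial (Fin n) K)
    (deg : Fin s → ℕ) (d : ℕ) (i : Fin s) (S : State K n) : Prop where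
  prev : Computed w f d i (S.mac d i) (S.red d i)
  criterion : deg i ≤ d → Computed w f (d - deg i) i (S.mac (d - deg i) i) (S.red (d - deg i) i)
  lower : ∀ d', d = d' + 1 → Computed w f d' (i + 1) (S.mac d' (i + 1)) (S.red d' (i + 1))

-- The stored echelon basis has all the leading monomials of its degree, so the test made by the
-- algorithm retains exactly the standard monomials.
open Classical in
theorem newRows_eq (hf : ∀ i, (f i).IsHomogeneous (deg i)) {d : ℕ} {i : Fin s} {S : State K n}
    (h : Ready w f deg d i S) (hd : deg i ≤ d) :
    newRows w S d i (deg i) (f i) =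
      ((stdMonomials w (prefixIdeal f i) (d - deg i)).map fun α => monomial α 1).map
        (LinearMap.mulLeft K (f i)) := by
  have hc := h.criterion hd
  rw [newRows, if_pos hd, List.map_map, stdMonomials]
  have h1 : ∀ α ∈ columns w (d - deg i), (∃ r ∈ S.red (d - deg i) i, IsLM w r α) ↔
      α ∈ LM w (prefixIdeal f i) := by
    intro α hα
    constructor
    · rintro ⟨r, hr, hr0, hrd⟩
      exact ⟨r, (mem_homPart_of_mem hc.red_span hr).1, hr0, hrd⟩
    · intro hα'
      obtain ⟨r, hr, hrd⟩ := exists_mem_degree_eq (hasComponents_prefixIdeal hf i) hc.echelon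
        hc.red_span (mem_columns.1 hα) hα'
      exact ⟨r, hr, hc.echelon.1 r hr, hrd⟩
  rw [List.filter_congr (q := fun α => decide (α ∉ LM w (prefixIdeal f i)))
    (fun α hα => by simp only [h1 α hα])]
  refine List.map_congr_left fun α _ => ?_
  simp [mul_comm]

theorem listSpan_buildMatrix (hf : ∀ i, (f i).IsHomogeneous (deg i)) {d : ℕ} {i : Fin s}
    {S : State K n} (h : Ready w f deg d i S) :
    listSpan (buildMatrix w reuse S d i (deg i) (f i)) = homPart (prefixIdeal f (i + 1)) d := by
  have hprev : listSpan (if reuse then S.red d i else S.mac d i) =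
      homPart (prefixIdeal f i) d := by
    split_ifs
    · exact h.prev.red_span
    · exact h.prev.mac_span
  rw [buildMatrix, listSpan_append, hprev, prefixIdeal_succ]
  by_cases hd : deg i ≤ d
  · rw [newRows_eq hf h hd, listSpan_map,
      homPart_sup_span_of_le (w := w) (hasComponents_prefixIdeal hf i) (hf i) hd, stdSpan]
  · rw [newRows, if_neg hd, listSpan_nil, sup_bot_eq,
      homPart_sup_span_of_lt (hasComponents_prefixIdeal hf i) (hf i) (not_le.1 hd)]

/-- The previous matrix contributes dim (I_{i-1})_d rows in both variants, because `Computed` gives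
`mac` and `red` the same length; `finrank_sup_map_eq_iff` then compares dimensions. -/
theorem finrank_eq_length_iff (hf : ∀ i, (f i).IsHomogeneous (deg i)) {d : ℕ} {i : Fin s}
    {S : State K n} (h : Ready w f deg d i S) :
    finrank K (homPart (prefixIdeal f (i + 1)) d) =
      (buildMatrix w reuse S d i (deg i) (f i)).length ↔ RegularAt f deg d i := by
  have hI := hasComponents_prefixIdeal hf i
  have hprev : (if reuse then S.red d i else S.mac d i).length =
      finrank K (homPart (prefixIdeal f i) d) := by
    rw [h.prev.finrank_eq]
    split_ifs
    · rfl
    · exact h.prev.length_eq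
  rw [buildMatrix, List.length_append, hprev, prefixIdeal_succ]
  by_cases hd : deg i ≤ d
  · rw [newRows_eq hf h hd, List.length_map, List.length_map, ← finrank_stdSpan,
      homPart_sup_span_of_le (w := w) hI (hf i) hd, finrank_sup_map_eq_iff]
    simp only [LinearMap.mulLeft_apply, RegularAt, hd, true_imp_iff]
    constructor
    -- The rank condition concerns standard cofactors only; the component of `p` in the ideal is
    -- harmless.
    · intro H p hp hfp
      have hp' : p ∈ homogeneousSubmodule (Fin n) K (d - deg i) := hp
      rw [← homPart_sup_stdSpan (w := w) hI] at hp'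
      obtain ⟨x, hx, y, hy, rfl⟩ := Submodule.mem_sup.1 hp'
      have hfy : f i * y ∈ prefixIdeal f i := by
        rw [mul_add] at hfp
        exact (Ideal.add_mem_iff_right _ (Ideal.mul_mem_left _ _ hx.1)).1 hfp
      have hyd := (hf i).mul (stdSpan_le _ _ hy)
      rw [Nat.add_sub_cancel' hd] at hyd
      rw [H y hy ⟨hfy, hyd⟩, add_zero]
      exact hx.1
    · intro H y hy hfy
      exact eq_zero_of_mem_stdSpan hy (H y (stdSpan_le _ _ hy) hfy.1)
  · rw [newRows, if_neg hd, homPart_sup_span_of_lt hI (hf i) (not_le.1 hd)]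
    simp [RegularAt, hd]

theorem mem_multiples {S : State K n} {d i : ℕ} {t : MvPolynomial (Fin n) K} :
    t ∈ multiples S d i ↔ ∃ d', d = d' + 1 ∧ ∃ k, ∃ r ∈ S.red d' i, t = X k * r := by
  cases d with
  | zero => simp [multiples]
  | succ d => simp [multiples, eq_comm]

theorem multiples_mem {d : ℕ} {i : Fin s} {S : State K n} (h : Ready w f deg d i S) :
    ∀ t ∈ multiples S d (i + 1), t ∈ homPart (prefixIdeal f (i + 1)) d := by
  intro t ht
  obtain ⟨d', rfl, k, r, hr, rfl⟩ := mem_multiples.1 ht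
  have := mem_homPart_of_mem (h.lower d' rfl).red_span hr
  refine ⟨Ideal.mul_mem_left _ _ this.1, ?_⟩
  rw [add_comm]
  exact (isHomogeneous_X K k).mul this.2

theorem Step.of_some (hf : ∀ i, (f i).IsHomogeneous (deg i)) {d : ℕ} {i : Fin s}
    {S S' : State K n} (h : Ready w f deg d i S)
    (hstep : Step v w reuse f deg d i S (some S')) :
    (∃ M R, S' = S.store w d i M R ∧ Computed w f d (i + 1) M R) ∧
      RegularAt f deg d i ∧ WeaklyAt w (prefixIdeal f (i + 1)) d := by
  cases hstep with
  | success pivots rest T hech hT =>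
    have hM := listSpan_buildMatrix (reuse := reuse) hf h
    obtain ⟨hs, hlen, hrank⟩ := hT.listSpan_eq hech hM (multiples_mem h)
    refine ⟨⟨_, _, rfl, hT.2.2, hs, hM, hlen.symm⟩, (finrank_eq_length_iff hf h).1 hrank,
      hT.weaklyAt (hasComponents_prefixIdeal hf _) hech hM (multiples_mem h) ?_⟩
    intro t ht
    obtain ⟨d', rfl, k, r, hr, rfl⟩ := mem_multiples.1 ht
    exact ⟨k, r, (mem_homPart_of_mem (h.lower d' rfl).red_span hr).1, rfl⟩

theorem not_step_none (hf : ∀ i, (f i).IsHomogeneous (deg i)) {d : ℕ} {i : Fin s}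
    {S : State K n} (h : Ready w f deg d i S) (hreg : RegularAt f deg d i)
    (hw : WeaklyAt w (prefixIdeal f (i + 1)) d) : ¬ Step v w reuse f deg d i S none := by
  intro hstep
  cases hstep with
  | error pivots rest hech hT =>
    refine hT (exists_isCompletion (hasComponents_prefixIdeal hf _) hech
      (listSpan_buildMatrix hf h) ((finrank_eq_length_iff hf h).2 hreg) hw ?_)
    rintro δ hδ rfl k
    have hc := h.lower _ rfl
    obtain ⟨r, hr, hrd⟩ := exists_mem_degree_eq (hasComponents_prefixIdeal hf _) hc.echelon
      hc.red_span rfl hδ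
    have hr0 := hc.echelon.1 r hr
    refine ⟨X k * r, mem_multiples.2 ⟨_, rfl, k, r, hr, rfl⟩, mul_ne_zero (X_ne_zero k) hr0, ?_⟩
    rw [w.degree_mul (X_ne_zero k) hr0, w.degree_X, hrd, add_comm]

/-! ### Existence of runs and induction along a loop. -/

theorem exists_step (v : Valuation K Γ₀) (w : MonomialOrder (Fin n)) (reuse : Bool)
    (f : Fin s → MvPolynomial (Fin n) K) (deg : Fin s → ℕ) (d : ℕ) (i : Fin s) (S : State K n) :
    ∃ o, Step v w reuse f deg d i S o := by
  obtain ⟨pivots, rest, hech⟩ := exists_partialEchelon v (columns w d)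
    (buildMatrix w reuse S d i (deg i) (f i))
  by_cases hT : ∃ T, IsCompletion w (multiples S d (i + 1)) pivots rest T
  · obtain ⟨T, hT⟩ := hT
    exact ⟨_, .success pivots rest T hech hT⟩
  · exact ⟨_, .error pivots rest hech hT⟩

theorem exists_loop {ι σ : Type*} {step : ι → σ → Option σ → Prop}
    (h : ∀ a S, ∃ o, step a S o) (l : List ι) (S : σ) : ∃ out, Loop step l S out := by
  induction l generalizing S with
  | nil => exact ⟨_, .nil S⟩
  | cons a l ih =>
    obtain ⟨o, ho⟩ := h a S
    cases o with
    | none => exact ⟨_, .error a l S ho⟩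
    | some S' =>
      obtain ⟨out, hout⟩ := ih S'
      exact ⟨out, .next a l S S' out ho hout⟩

/-- Induction along a loop: an invariant which is preserved by successful steps holds at the end,
or at the step which raises an error. -/
theorem Loop.induct {ι σ : Type*} {step : ι → σ → Option σ → Prop} {l : List ι}
    {P : List ι → σ → Prop}
    (hstep : ∀ done a rest S S', l = done ++ a :: rest → P done S → step a S (some S') →
      P (done ++ [a]) S')
    {done rest : List ι} {S : σ} {out : Option σ} (hl : l = done ++ rest) (hP : P done S)
    (h : Loop step rest S out) :
    (∃ S', out = some S' ∧ P l S') ∨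
      (out = none ∧ ∃ done a rest S, l = done ++ a :: rest ∧ P done S ∧ step a S none) := by
  induction h generalizing done with
  | nil S => exact Or.inl ⟨S, rfl, by simpa [hl] using hP⟩
  | next a rest S S' out h _ ih =>
    exact ih (done := done ++ [a]) (by simp [hl]) (hstep _ _ _ _ _ hl hP h)
  | error a rest S h => exact Or.inr ⟨rfl, done, a, rest, S, hl, hP, h⟩

/-! ### Lexicographic order of the indices and the loop invariant. -/

/-- The loop indices, in the order of the algorithm. -/
theorem pairwise_product (D s : ℕ) :
    ((List.range (D + 1)).product (List.finRange s)).Pairwise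
      fun a b => a.1 < b.1 ∨ (a.1 = b.1 ∧ a.2 < b.2) := by
  rw [List.product, List.pairwise_flatMap]
  refine ⟨fun d _ => ?_, List.pairwise_lt_range.imp fun h => ?_⟩
  · rw [List.pairwise_map]
    exact (List.pairwise_lt_finRange s).imp fun h => Or.inr ⟨rfl, h⟩
  · simp only [List.mem_map]
    rintro _ ⟨i, -, rfl⟩ _ ⟨j, -, rfl⟩
    exact Or.inl h

theorem mem_product_range {D d : ℕ} {i : Fin s} :
    (d, i) ∈ (List.range (D + 1)).product (List.finRange s) ↔ d ≤ D :=
  List.mem_product.trans (by simp)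

/-- The list is strictly increasing for the lexicographic order, so a smaller index is neither (d,i)
nor behind it. -/
theorem mem_done {D d d' : ℕ} {i i' : Fin s} {done rest : List (ℕ × Fin s)}
    (hl : (List.range (D + 1)).product (List.finRange s) = done ++ (d, i) :: rest)
    (h : d' < d ∨ (d' = d ∧ i' < i)) : (d', i') ∈ done := by
  have hpw := pairwise_product D s
  have hd : (d, i) ∈ (List.range (D + 1)).product (List.finRange s) := by rw [hl]; simp
  have hd' : (d', i') ∈ (List.range (D + 1)).product (List.finRange s) := by
    rw [mem_product_range] at hd ⊢
    omega
  rw [hl, List.mem_append] at hd'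
  rw [hl, List.pairwise_append, List.pairwise_cons] at hpw
  rcases hd' with hd' | hd'
  · exact hd'
  rcases List.mem_cons.1 hd' with he | hd'
  · rw [Prod.mk.injEq] at he
    obtain ⟨rfl, rfl⟩ := he
    exact absurd h (by simp)
  · have := hpw.2.1.1 _ hd'
    simp only [Fin.lt_def] at this h
    omega

/-- The loop invariant of the algorithm; `done` is the list of the indices treated so far. -/
structure Invariant (w : MonomialOrder (Fin n)) (f : Fin s → MvPolynomial (Fin n) K)
    (deg : Fin s → ℕ) (done : List (ℕ × Fin s)) (S : State K n) : Prop where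
  zero : ∀ d, Computed w f d 0 (S.mac d 0) (S.red d 0)
  computed : ∀ a ∈ done, Computed w f a.1 (a.2 + 1) (S.mac a.1 (a.2 + 1)) (S.red a.1 (a.2 + 1))
  basis_mem : ∀ g ∈ S.basis, g ≠ 0 ∧ g ∈ Ideal.span (Set.range f)
  basis_degree : ∀ a ∈ done, ∀ r ∈ S.red a.1 (a.2 + 1), ∃ g ∈ S.basis, w.degree g = w.degree r
  regular : ∀ a ∈ done, RegularAt f deg a.1 a.2
  weakly : ∀ a ∈ done, WeaklyAt w (prefixIdeal f (a.2 + 1)) a.1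

theorem invariant_init : Invariant w f deg [] (State.init K n) where
  zero := computed_nil
  computed := by simp
  basis_mem := by simp [State.init]
  basis_degree := by simp
  regular := by simp
  weakly := by simp

/-- Every matrix read belongs to a lexicographically smaller index: when `deg i = 0` the criterion
reads degree `d` itself, but for the previous polynomials only. -/
theorem Invariant.ready {D d : ℕ} {i : Fin s} {done rest : List (ℕ × Fin s)} {S : State K n}
    (h : Invariant w f deg done S)
    (hl : (List.range (D + 1)).product (List.finRange s) = done ++ (d, i) :: rest) :
    Ready w f deg d i S := by
  have key : ∀ d' ≤ d, Computed w f d' i (S.mac d' i) (S.red d' i) := by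
    intro d' hd'
    -- Matrices for the first `i` polynomials are produced at loop index `i - 1`; those for `i = 0`
    -- are never computed.
    rcases Nat.eq_zero_or_pos (i : ℕ) with hi | hi
    · rw [hi]
      exact h.zero d'
    · have hm : (d', (⟨i - 1, by omega⟩ : Fin s)) ∈ done := by
        refine mem_done hl ?_
        rw [Fin.lt_def]
        simp only
        omega
      have := h.computed _ hm
      simpa only [Nat.sub_add_cancel hi] using this
  refine ⟨key d le_rfl, fun _ => key _ (Nat.sub_le _ _), ?_⟩
  rintro d' rfl
  exact h.computed _ (mem_done (i' := i) hl (Or.inl d'.lt_succ_self))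

theorem State.store_red_self (S : State K n) (d i : ℕ) (M R : List (MvPolynomial (Fin n) K)) :
    (S.store w d i M R).red d (i + 1) = R := by
  simp [State.store]

theorem State.store_mac_self (S : State K n) (d i : ℕ) (M R : List (MvPolynomial (Fin n) K)) :
    (S.store w d i M R).mac d (i + 1) = M := by
  simp [State.store]

theorem State.store_red_of_ne (S : State K n) {d i d' i' : ℕ}
    (M R : List (MvPolynomial (Fin n) K)) (h : ¬ (d' = d ∧ i' = i + 1)) :
    (S.store w d i M R).red d' i' = S.red d' i' := by
  by_cases hd : d' = d
  · subst hd
    have hi : i' ≠ i + 1 := fun hi => h ⟨rfl, hi⟩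
    simp [State.store, hi]
  · simp [State.store, hd]

theorem State.store_mac_of_ne (S : State K n) {d i d' i' : ℕ}
    (M R : List (MvPolynomial (Fin n) K)) (h : ¬ (d' = d ∧ i' = i + 1)) :
    (S.store w d i M R).mac d' i' = S.mac d' i' := by
  by_cases hd : d' = d
  · subst hd
    have hi : i' ≠ i + 1 := fun hi => h ⟨rfl, hi⟩
    simp [State.store, hi]
  · simp [State.store, hd]

theorem Invariant.store {d : ℕ} {i : Fin s} {done : List (ℕ × Fin s)} {S : State K n}
    (h : Invariant w f deg done S) {M R : List (MvPolynomial (Fin n) K)}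
    (hc : Computed w f d (i + 1) M R) (hreg : RegularAt f deg d i)
    (hw : WeaklyAt w (prefixIdeal f (i + 1)) d) :
    Invariant w f deg (done ++ [(d, i)]) (S.store w d i M R) := by
  have hbasis : ∀ r ∈ R, ∃ g ∈ (S.store w d i M R).basis, w.degree g = w.degree r := by
    intro r hr
    by_cases hg : ∃ g ∈ S.basis, w.degree g = w.degree r
    · obtain ⟨g, hg, hgd⟩ := hg
      exact ⟨g, List.mem_append_left _ hg, hgd⟩
    · exact ⟨r, List.mem_append_right _ (List.mem_filter.2 ⟨hr, by simpa using hg⟩), rfl⟩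
  constructor
  · intro d'
    -- Storing writes at `i + 1`, never at 0.
    rw [State.store_mac_of_ne _ _ _ (by simp), State.store_red_of_ne _ _ _ (by simp)]
    exact h.zero d'
  · rintro ⟨d', i'⟩ ha
    by_cases he : d' = d ∧ (i' : ℕ) + 1 = i + 1
    · obtain ⟨rfl, hi⟩ := he
      simp only [hi]
      rwa [State.store_mac_self, State.store_red_self]
    · simp only [State.store_mac_of_ne _ _ _ he, State.store_red_of_ne _ _ _ he]
      refine h.computed (d', i') ?_
      rcases List.mem_append.1 ha with ha | ha
      · exact ha
      · simp only [List.mem_singleton, Prod.mk.injEq] at ha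
        exact absurd ⟨ha.1, by rw [ha.2]⟩ he
  · intro g hg
    rcases List.mem_append.1 hg with hg | hg
    · exact h.basis_mem g hg
    · have hgR := List.mem_of_mem_filter hg
      exact ⟨hc.echelon.1 g hgR,
        prefixIdeal_le_range f _ (mem_homPart_of_mem hc.red_span hgR).1⟩
  · rintro ⟨d', i'⟩ ha
    by_cases he : d' = d ∧ (i' : ℕ) + 1 = i + 1
    · obtain ⟨rfl, hi⟩ := he
      simp only [hi]
      rwa [State.store_red_self]
    · simp only [State.store_red_of_ne _ _ _ he]
      intro r hr
      rcases List.mem_append.1 ha with ha | ha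
      · obtain ⟨g, hg, hgd⟩ := h.basis_degree (d', i') ha r hr
        exact ⟨g, List.mem_append_left _ hg, hgd⟩
      · simp only [List.mem_singleton, Prod.mk.injEq] at ha
        exact absurd ⟨ha.1, by rw [ha.2]⟩ he
  · intro a ha
    rcases List.mem_append.1 ha with ha | ha
    · exact h.regular a ha
    · rw [List.mem_singleton.1 ha]
      exact hreg
  · intro a ha
    rcases List.mem_append.1 ha with ha | ha
    · exact h.weakly a ha
    · rw [List.mem_singleton.1 ha]
      exact hw

/-- The result of a run: either the invariant holds for all the indices, or an error was raised in a
state where it holds for the preceding ones. -/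
theorem Run.cases (hf : ∀ i, (f i).IsHomogeneous (deg i)) {D : ℕ}
    {out : Option (List (MvPolynomial (Fin n) K))} (h : Run v w reuse f deg D out) :
    (∃ S, out = some S.basis ∧
      Invariant w f deg ((List.range (D + 1)).product (List.finRange s)) S) ∨
    (out = none ∧ ∃ d i S, Ready w f deg d i S ∧ Step v w reuse f deg d i S none) := by
  obtain ⟨o, hloop, rfl⟩ := h
  have := Loop.induct (l := (List.range (D + 1)).product (List.finRange s))
    (P := Invariant w f deg) ?_ (done := []) rfl invariant_init hloop
  · rcases this with ⟨S, rfl, hS⟩ | ⟨rfl, done, ⟨d, i⟩, rest, S, hl, hS, hstep⟩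
    · exact Or.inl ⟨S, rfl, hS⟩
    · exact Or.inr ⟨rfl, d, i, S, hS.ready hl, hstep⟩
  · rintro done ⟨d, i⟩ rest S S' hl hS hstep
    obtain ⟨⟨M, R, rfl, hc⟩, hreg, hw⟩ := Step.of_some hf (hS.ready hl) hstep
    exact hS.store hc hreg hw

theorem Invariant.isDGroebnerBasis (hf : ∀ i, (f i).IsHomogeneous (deg i)) {D : ℕ} {S : State K n}
    (h : Invariant w f deg ((List.range (D + 1)).product (List.finRange s)) S) :
    IsDGroebnerBasis w D (Ideal.span (Set.range f)) S.basis := by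
  refine ⟨fun g hg => (h.basis_mem g hg).2, fun p hp hp0 d hd hpd => ?_⟩
  rw [← prefixIdeal_length] at hp
  -- Without polynomials there is no last matrix, but the ideal is zero.
  rcases s with _ | s
  · rw [prefixIdeal_zero] at hp
    exact absurd hp hp0
  -- After the last polynomial, the matrix of degree `d` is a basis of that part of the whole ideal.
  have hm : (d, Fin.last s) ∈ (List.range (D + 1)).product (List.finRange (s + 1)) :=
    mem_product_range.2 hd
  have hc := h.computed _ hm
  obtain ⟨r, hr, hrd⟩ := hc.echelon.exists_degree_eq (p := p)
    (by rw [hc.red_span]; exact ⟨by simpa using hp, hpd⟩) hp0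
  obtain ⟨g, hg, hgd⟩ := h.basis_degree _ hm r hr
  exact ⟨g, hg, (h.basis_mem g hg).1, by rw [hgd, hrd]⟩

end Run

end WeakMF5

theorem proposition3p3 {K : Type*} [Field K] {Γ₀ : Type*} [LinearOrderedCommGroupWithZero Γ₀]
    (v : Valuation K Γ₀) {n s : ℕ} (w : MonomialOrder (Fin n))
    (f : Fin s → MvPolynomial (Fin n) K) (deg : Fin s → ℕ)
    (hf : ∀ i, (f i).IsHomogeneous (deg i)) :
    (∀ (D : ℕ) (reuse : Bool), ∃ out, WeakMF5.Run v w reuse f deg D out) ∧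
    (WeakMF5.H1 f → WeakMF5.H2 w f → ∀ (D : ℕ) (reuse : Bool) (out),
      WeakMF5.Run v w reuse f deg D out →
        ∃ G, out = some G ∧ WeakMF5.IsDGroebnerBasis w D (Ideal.span (Set.range f)) G) ∧
    (¬ (WeakMF5.H1 f ∧ WeakMF5.H2 w f) → ∃ D₀ : ℕ, ∀ D ≥ D₀, ∀ (reuse : Bool) (out),
      WeakMF5.Run v w reuse f deg D out → out = none) := by
  refine ⟨fun D reuse => ?_, fun h1 h2 D reuse out hrun => ?_, fun hnot => ?_⟩
  · obtain ⟨o, ho⟩ := WeakMF5.exists_loop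
      (fun (a : ℕ × Fin s) S => WeakMF5.exists_step v w reuse f deg a.1 a.2 S)
      ((List.range (D + 1)).product (List.finRange s)) (WeakMF5.State.init K n)
    exact ⟨_, o, ho, rfl⟩
  · rw [WeakMF5.H1_iff_regularAt hf] at h1
    rw [WeakMF5.H2_iff_weaklyAt] at h2
    rcases hrun.cases hf with ⟨S, rfl, hS⟩ | ⟨-, d, i, S, hS, hstep⟩
    · exact ⟨_, rfl, hS.isDGroebnerBasis hf⟩
    · exact absurd hstep (WeakMF5.not_step_none hf hS (h1 d i) (h2 d i))
  · rw [WeakMF5.H1_iff_regularAt hf, WeakMF5.H2_iff_weaklyAt, ← forall_and] at hnot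
    simp only [← forall_and] at hnot
    push Not at hnot
    obtain ⟨d, i, hdi⟩ := hnot
    -- D₀ is a degree in which a local condition fails: a run without error up to D ≥ d treats
    -- (d,i), and the invariant would give both conditions there.
    refine ⟨d, fun D hD reuse out hrun => ?_⟩
    rcases hrun.cases hf with ⟨S, rfl, hS⟩ | ⟨rfl, -⟩
    · have hm : (d, i) ∈ (List.range (D + 1)).product (List.finRange s) :=
        WeakMF5.mem_product_range.2 hD
      exact absurd (hS.weakly _ hm) (hdi (hS.regular _ hm))
    · rfl
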